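/- Fix the algebraic closure $\overline{\mathbb Q}\subset\mathbb C$ of $\mathbb Q$, put $\zeta_N=e^{2i\pi/N}$, and let $p$ be an odd prime. Let $F\subset\overline{\mathbb Q}$ be a totally real abelian number field with $G=\mathrm{Gal}(F/\mathbb Q)$ and conductor $dp^a$, $p\nmid d$; put $F_m=F(\zeta_{p^m})$. Let $\Omega_S\subset\overline{\mathbb Q}$ be the maximal algebraic extension of $F$ unramified at all primes not dividing $p$, $\mathcal G_S=\mathrm{Gal}(\Omega_S/\mathbb Q)$, $G_S=\mathrm{Gal}(\Omega_S/F)$, $G_S(F_m)=\mathrm{Gal}(\Omega_S/F_m)$, and let $\kappa:\mathcal G_S\to\mathbb Z_p^\times$ be the cyclotomic character. For $r\ge 0$ let $\mathbb Z/p^m(r)$ be $\mathbb Z/p^m$ with $\sigma\in\mathcal G_S$ acting as $\kappa(\sigma)^r$, with generator $t(r)_m$, where $t(1)_m$ corresponds to $\zeta_{p^m}$ under $\mathbb Z/p^m(1)\cong\mu_{p^m}$ and $t(r)_m=t(1)_m^{\otimes r}$. Let $r>1$ be an odd integer, and $H^1(G_S,\mathbb Z_p(r))=\varprojlim_m H^1(G_S,\mathbb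 Z/p^m(r))$ (continuous cohomology). *The special element.* For $m\ge a$ let $\varepsilon_m=N_{\mathbb Q(\zeta_{dp^m})/F_m\cap\mathbb Q(\zeta_{dp^m})}(1-\zeta_{dp^m})$, and for $m<a$ let $\varepsilon_m=N_{F_a/F_m}(\varepsilon_a)$. For $m\ge 1$ let $x_m\in H^1(G_S(F_m),\mathbb Z/p^m(r))$ be the class of the Kummer cocycle $\sigma\mapsto \frac{\sigma(\sqrt[p^m]{\varepsilon_m})}{\sqrt[p^m]{\varepsilon_m}}\otimes t(r-1)_m$, and let $c^F(r)=(\mathrm{cor}_{F_m/F}(x_m))_m$. *The reduction map.* Let $n\ge 1$ with $n\ge a$, let $\ell$ be a prime number with $\ell\equiv 1 \pmod{dp^n}$, and let $\mathfrak L$ be a prime ideal above $\ell$ of the ring of all algebraic integers of $\overline{\mathbb Q}$; put $\lambda=\mathfrak L\cap F$. For each $g\in G$ let $a_g\in\mathbb Z$ and $\tau_g\in\mathrm{Gal}(\overline{\mathbb Q}/\mathbb Q)$ be such that $\tau_g$ restricts to $g$ on $F$ and $\tau_g(\zeta_{dp^n}^{a_g})=\zeta_{dp^n}$ (so $a_g$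 represents $g^{-1}$). Put $\lambda^g=g(\lambda)$, with residue field $\mathbb F_{\lambda^g}=\mathbb F_\ell$, and let $\mathcal L(\lambda^g)=\tau_g(\mathfrak L)\cap\Omega_S$, with decomposition group $D_g\subset G_S$. Let $$\phi_{\ell,n}:H^1(G_S,\mathbb Z/p^n(r))\longrightarrow\bigoplus_{g\in G}H^1(D_g,\mathbb Z/p^n(r))$$ be the sum of the restriction maps. The target is identified with $\bigoplus_{g\in G}(\mathbb F_{\lambda^g}^\times/p^n)(r-1)$ by the Kummer map, which sends $b\otimes t(r-1)_n$ to the class of $\sigma\mapsto\frac{\sigma(v)}{v}\otimes t(r-1)_n$, where $v$ is a $p^n$-th root of $b$ in the residue field of $\Omega_S$ at $\mathcal L(\lambda^g)$ and $\mu_{p^n}$ of that residue field is identified with $\mu_{p^n}\subset\Omega_S$ by reduction. **Proposition.** Let $\xi_\ell\in\mathbb Z$ be a primitive root modulo $\ell$ such that $\zeta_{dp^n}\equiv\xi_\ell^{(\ell-1)/(dp^n)}\pmod{\mathfrak L}$. Let $I_{F,n}\subset\mathbb Z$ be a system of representatives of $\mathrm{Gal}(\mathbb Q(\zeta_{dp^n})/F)\subset\mathrm{Gal}(\mathbb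 Q(\zeta_{dp^n})/\mathbb Q)\cong(\mathbb Z/dp^n)^\times$. Then $c^F(r)$ is an element of $H^1(G_S,\mathbb Z_p(r))$, and (applying $\phi_{\ell,n}$ to its image in $H^1(G_S,\mathbb Z/p^n(r))$) $$\phi_{\ell,n}(c^F(r))=\Big(\prod_{i\in I_{F,n}}\big(1-\xi_\ell^{\,a_g i(\ell-1)/(dp^n)}\big)^{i^{r-1}}\otimes t(r-1)_n\Big)_{g\in G}.$$ -/

import Mathlib

open scoped NumberField Pointwise

noncomputable section

namespace TwistedCyclotomic

/-! ## Continuous cohomology in degree one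

`Γ` is a topological group acting additively on a discrete abelian group `M` through `ρ`, and the
subgroups of `Γ` act on `M` by restriction. -/

section Cosets

variable {Γ : Type*} [Group Γ]

/-- A system of representatives of the left cosets of `V` in `U`. -/
def rep {U V : Subgroup Γ} (c : U ⧸ V.subgroupOf U) : U := Quotient.out c

lemma rep_mem {U V : Subgroup Γ} (g : U) (c : U ⧸ V.subgroupOf U) :
    (((rep (g • c))⁻¹ * g * rep c : U) : Γ) ∈ V := by
  have h : (QuotientGroup.mk (rep (g • c)) : U ⧸ V.subgroupOf U)
      = QuotientGroup.mk (g * rep c) := by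
    have h1 : (QuotientGroup.mk (rep (g • c)) : U ⧸ V.subgroupOf U) = g • c :=
      QuotientGroup.out_eq' _
    have h2 : (QuotientGroup.mk (rep c) : U ⧸ V.subgroupOf U) = c := QuotientGroup.out_eq' _
    rw [h1]
    conv_lhs => rw [← h2]
    rfl
  rw [QuotientGroup.eq] at h
  rw [mul_assoc]
  exact h

end Cosets

section Cohomology

variable {Γ : Type*} [Group Γ] [TopologicalSpace Γ]
variable {M : Type*} [AddCommGroup M] (ρ : Γ →* AddMonoid.End M)

/-- Continuous 1-cocycles `f : U → M`, `f (g h) = f g + g f(h)` (as `M` is discrete, continuous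
means locally constant). -/
def Z1 (U : Subgroup Γ) : AddSubgroup (U → M) where
  carrier := {f | IsLocallyConstant f ∧ ∀ g h : U, f (g * h) = f g + ρ (g : Γ) (f h)}
  zero_mem' := ⟨IsLocallyConstant.const 0, fun g h => by simp⟩
  add_mem' := by
    rintro a b ⟨ha, ha'⟩ ⟨hb, hb'⟩
    refine ⟨ha.add hb, fun g h => ?_⟩
    simp only [Pi.add_apply, ha', hb', map_add]
    abel
  neg_mem' := by
    rintro a ⟨ha, ha'⟩
    refine ⟨ha.neg, fun g h => ?_⟩
    simp only [Pi.neg_apply, ha', map_neg]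
    abel

/-- 1-coboundaries `g ↦ g m - m`. -/
def B1 (U : Subgroup Γ) : AddSubgroup (U → M) where
  carrier := {f | ∃ m : M, ∀ g : U, f g = ρ (g : Γ) m - m}
  zero_mem' := ⟨0, fun g => by simp⟩
  add_mem' := by
    rintro a b ⟨m, hm⟩ ⟨m', hm'⟩
    refine ⟨m + m', fun g => ?_⟩
    simp only [Pi.add_apply, hm, hm', map_add]
    abel
  neg_mem' := by
    rintro a ⟨m, hm⟩
    refine ⟨-m, fun g => ?_⟩
    simp only [Pi.neg_apply, hm, map_neg]
    abel

/-- `H¹(U, M)`: continuous 1-cocycles modulo 1-coboundaries. -/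
abbrev H1 (U : Subgroup Γ) : Type _ := Z1 ρ U ⧸ (B1 ρ U).addSubgroupOf (Z1 ρ U)

/-- The class of a continuous 1-cocycle. -/
def H1.mk (U : Subgroup Γ) : Z1 ρ U →+ H1 ρ U :=
  QuotientAddGroup.mk' ((B1 ρ U).addSubgroupOf (Z1 ρ U))

/-- Restriction of cocycles to a smaller subgroup. -/
def Z1.res {U V : Subgroup Γ} (h : V ≤ U) : Z1 ρ U →+ Z1 ρ V where
  toFun f := ⟨fun v => f.1 ⟨v, h v.2⟩,
    f.2.1.comp_continuous (continuous_inclusion h), fun a b => f.2.2 ⟨a, h a.2⟩ ⟨b, h b.2⟩⟩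
  map_zero' := rfl
  map_add' _ _ := rfl

/-- The restriction `H¹(U, M) → H¹(V, M)` for `V ≤ U`. -/
def H1.res {U V : Subgroup Γ} (h : V ≤ U) : H1 ρ U →+ H1 ρ V :=
  QuotientAddGroup.map _ _ (Z1.res ρ h) (by
    rintro f ⟨m, hm⟩
    exact ⟨m, fun g => hm ⟨g, h g.2⟩⟩)

/-- The map `H¹(U, M) → H¹(U, M')` induced by an equivariant homomorphism `M → M'`. -/
def H1.coeffMap {M' : Type*} [AddCommGroup M'] (ρ' : Γ →* AddMonoid.End M') (φ : M →+ M')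
    (hφ : ∀ g m, φ (ρ g m) = ρ' g (φ m)) (U : Subgroup Γ) : H1 ρ U →+ H1 ρ' U :=
  QuotientAddGroup.map _ _
    ({ toFun := fun f => ⟨fun u => φ (f.1 u), f.2.1.comp φ, fun a b => by
          simp only [f.2.2, map_add, hφ]⟩
       map_zero' := Subtype.ext (funext fun _ => map_zero φ)
       map_add' := fun _ _ => Subtype.ext (funext fun _ => map_add φ _ _) } : Z1 ρ U →+ Z1 ρ' U)
    (by
      rintro f ⟨m, hm⟩
      refine ⟨φ m, fun g => ?_⟩
      rw [← hφ, ← map_sub]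
      exact congrArg φ (hm g))

/-! ### Corestriction -/

variable {ρ}

/-- Corestriction of 1-cochains: for representatives `s(c)` of the left cosets `c` of `V` in `U`,
`(cor f)(g) = ∑_c s(g c) f(s(g c)⁻¹ g s(c))`. -/
def corFun (ρ : Γ →* AddMonoid.End M) {U V : Subgroup Γ} [Fintype (U ⧸ V.subgroupOf U)]
    (f : V → M) (g : U) : M :=
  ∑ c : U ⧸ V.subgroupOf U,
    ρ (rep (g • c) : U) (f ⟨((rep (g • c))⁻¹ * g * rep c : U), rep_mem g c⟩)

lemma corFun_mem_Z1 [IsTopologicalGroup Γ] {U V : Subgroup Γ} [Fintype (U ⧸ V.subgroupOf U)]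
    (hV : IsOpen (V : Set Γ)) {f : V → M} (hf : f ∈ Z1 ρ V) : corFun ρ f ∈ Z1 ρ U := by
  have hV' : IsOpen ((V.subgroupOf U : Subgroup U) : Set U) :=
    hV.preimage continuous_subtype_val
  have := QuotientGroup.discreteTopology hV'
  refine ⟨?_, fun g h => ?_⟩
  · rw [IsLocallyConstant.iff_exists_open]
    intro g
    have hc : ∀ c : U ⧸ V.subgroupOf U, ∃ W : Set U, IsOpen W ∧ g ∈ W ∧ ∀ g' ∈ W,
        g' • c = g • c ∧ ∀ h, f ⟨((rep (g • c))⁻¹ * g * rep c : U), rep_mem g c⟩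
          = f ⟨((rep (g • c))⁻¹ * g' * rep c : U), h⟩ := by
      intro c
      have h1 : IsOpen {g' : U | g' • c = g • c} := by
        have hcont : Continuous fun g' : U => g' • c := by
          have h2 : (QuotientGroup.mk (rep c) : U ⧸ V.subgroupOf U) = c :=
            QuotientGroup.out_eq' _
          have h3 : (fun g' : U => g' • c)
              = fun g' : U => (QuotientGroup.mk (g' * rep c) : U ⧸ V.subgroupOf U) := by
            funext g'
            conv_lhs => rw [← h2]
            rfl
          rw [h3]
          exact QuotientGroup.continuous_mk.comp (continuous_mul_const _)
        exact (isOpen_discrete ({g • c} : Set (U ⧸ V.subgroupOf U))).preimage hcont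
      let T : Set V := f ⁻¹' {f ⟨((rep (g • c))⁻¹ * g * rep c : U), rep_mem g c⟩}
      have hT : IsOpen T := hf.1.isOpen_fiber _
      obtain ⟨T', hT', hTT'⟩ := isOpen_induced_iff.1 hT
      refine ⟨{g' : U | g' • c = g • c} ∩
        {g' : U | (((rep (g • c))⁻¹ * g' * rep c : U) : Γ) ∈ T'},
        h1.inter (hT'.preimage (by fun_prop)), ⟨rfl, ?_⟩, ?_⟩
      · have : (⟨((rep (g • c))⁻¹ * g * rep c : U), rep_mem g c⟩ : V) ∈ T := rfl
        rw [← hTT'] at this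
        exact this
      · rintro g' ⟨hg1, hg2⟩
        refine ⟨hg1, fun h => ?_⟩
        have : (⟨((rep (g • c))⁻¹ * g' * rep c : U), h⟩ : V) ∈ T := by
          rw [← hTT']
          exact hg2
        exact this.symm
    choose W hW1 hW2 hW3 using hc
    refine ⟨⋂ c, W c, isOpen_iInter_of_finite hW1, Set.mem_iInter.2 hW2, fun g' hg' => ?_⟩
    refine Finset.sum_congr rfl fun c _ => ?_
    obtain ⟨h1, h2⟩ := hW3 c g' (Set.mem_iInter.1 hg' c)
    have key : ∀ c' : U ⧸ V.subgroupOf U, g • c = c' →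
        ∀ h : (((rep c')⁻¹ * g' * rep c : U) : Γ) ∈ V,
        ρ (rep c' : U) (f ⟨((rep c')⁻¹ * g' * rep c : U), h⟩)
          = ρ (rep (g • c) : U) (f ⟨((rep (g • c))⁻¹ * g * rep c : U), rep_mem g c⟩) := by
      rintro c' rfl h
      rw [h2 h]
    exact key _ h1.symm _
  · simp only [corFun, map_sum]
    have h1 : ∀ c : U ⧸ V.subgroupOf U,
        ρ (rep ((g * h) • c) : U)
          (f ⟨((rep ((g * h) • c))⁻¹ * (g * h) * rep c : U), rep_mem (g * h) c⟩)
        = ρ (rep (g • (h • c)) : U)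
            (f ⟨((rep (g • (h • c)))⁻¹ * g * rep (h • c) : U), rep_mem g (h • c)⟩)
          + ρ (g : Γ) (ρ (rep (h • c) : U)
            (f ⟨((rep (h • c))⁻¹ * h * rep c : U), rep_mem h c⟩)) := by
      intro c
      have key : ∀ c' : U ⧸ V.subgroupOf U, (g * h) • c = c' →
          ∀ (hm : (((rep c')⁻¹ * (g * h) * rep c : U) : Γ) ∈ V)
            (hm' : (((rep c')⁻¹ * g * rep (h • c) : U) : Γ) ∈ V),
          ρ (rep c' : U) (f ⟨((rep c')⁻¹ * (g * h) * rep c : U), hm⟩)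
            = ρ (rep c' : U) (f ⟨((rep c')⁻¹ * g * rep (h • c) : U), hm'⟩)
              + ρ (g : Γ) (ρ (rep (h • c) : U)
                (f ⟨((rep (h • c))⁻¹ * h * rep c : U), rep_mem h c⟩)) := by
        intro c' _ hm hm'
        have e : (⟨((rep c')⁻¹ * (g * h) * rep c : U), hm⟩ : V)
            = ⟨((rep c')⁻¹ * g * rep (h • c) : U), hm'⟩
              * ⟨((rep (h • c))⁻¹ * h * rep c : U), rep_mem h c⟩ := by
          apply Subtype.ext
          simp only [Subgroup.coe_mul, InvMemClass.coe_inv]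
          group
        rw [e, hf.2, map_add]
        congr 1
        change (ρ (rep c' : U) * ρ _) _ = (ρ (g : Γ) * ρ (rep (h • c) : U)) _
        rw [← map_mul, ← map_mul]
        congr 2
        simp only [Subgroup.coe_mul, InvMemClass.coe_inv]
        group
      have hc := mul_smul g h c
      have := key _ rfl (rep_mem (g * h) c) (by rw [hc]; exact rep_mem g (h • c))
      rw [this]
      congr 1
      have key2 : ∀ c' : U ⧸ V.subgroupOf U, c' = g • (h • c) →
          ∀ (hm : (((rep c')⁻¹ * g * rep (h • c) : U) : Γ) ∈ V),
          ρ (rep c' : U) (f ⟨((rep c')⁻¹ * g * rep (h • c) : U), hm⟩)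
            = ρ (rep (g • (h • c)) : U)
            (f ⟨((rep (g • (h • c)))⁻¹ * g * rep (h • c) : U), rep_mem g (h • c)⟩) := by
        rintro c' rfl hm
        rfl
      exact key2 _ hc _
    rw [Finset.sum_congr rfl fun c _ => h1 c, Finset.sum_add_distrib]
    congr 1
    exact Fintype.sum_equiv (MulAction.toPerm h) _ _ fun c => rfl

lemma corFun_mem_B1 {U V : Subgroup Γ} [Fintype (U ⧸ V.subgroupOf U)]
    {f : V → M} (hf : f ∈ B1 ρ V) : corFun ρ f ∈ B1 ρ U := by
  obtain ⟨m, hm⟩ := hf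
  refine ⟨∑ c : U ⧸ V.subgroupOf U, ρ (rep c : U) m, fun g => ?_⟩
  have h1 : ∀ c : U ⧸ V.subgroupOf U,
      ρ (rep (g • c) : U) (f ⟨((rep (g • c))⁻¹ * g * rep c : U), rep_mem g c⟩)
        = ρ (g : Γ) (ρ (rep c : U) m) - ρ (rep (g • c) : U) m := by
    intro c
    rw [hm, map_sub]
    congr 1
    change (ρ (rep (g • c) : U) * ρ _) _ = (ρ (g : Γ) * ρ (rep c : U)) _
    rw [← map_mul, ← map_mul]
    congr 2
    simp only [Subgroup.coe_mul, InvMemClass.coe_inv]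
    group
  unfold corFun
  rw [Finset.sum_congr rfl fun c _ => h1 c, Finset.sum_sub_distrib, map_sum]
  congr 1
  exact Fintype.sum_equiv (MulAction.toPerm g) _ _ fun c => rfl

variable (ρ)

/-- The corestriction `H¹(V, M) → H¹(U, M)` for an open subgroup `V` with `V ∩ U` of finite index
in `U` (used for `V ≤ U`). -/
def H1.cor [IsTopologicalGroup Γ] (U V : Subgroup Γ) [Finite (U ⧸ V.subgroupOf U)]
    (hV : IsOpen (V : Set Γ)) : H1 ρ V →+ H1 ρ U :=
  letI := Fintype.ofFinite (U ⧸ V.subgroupOf U)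
  QuotientAddGroup.map _ _
    ({ toFun := fun f => ⟨corFun ρ f.1, corFun_mem_Z1 hV f.2⟩
       map_zero' := Subtype.ext (funext fun g => by simp [corFun])
       map_add' := fun a b => Subtype.ext (funext fun g => by
        simp [corFun, Finset.sum_add_distrib]) } : Z1 ρ V →+ Z1 ρ U)
    (fun _ hf => corFun_mem_B1 hf)

end Cohomology

/-! ## Galois groups of subfields -/

section Galois

variable {K L : Type*} [Field K] [Field L] [Algebra K L]

/-- The Galois group `Gal(Ω/K)` of an intermediate field `K ⊆ Ω ⊆ L`; it carries the Krull
topology. -/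
abbrev GalOf (Ω : IntermediateField K L) : Type _ := Gal(Ω/K)

/-- For a field `Ω` and a field `E`, the group `Gal(Ω/Ω ∩ E)` as a subgroup of `Gal(Ω/K)`. For
`E ⊆ Ω` it is `Gal(Ω/E)`. -/
def galFix (Ω E : IntermediateField K L) : Subgroup (GalOf Ω) :=
  (E.comap Ω.val).fixingSubgroup

lemma mem_galFix {Ω E : IntermediateField K L} {σ : GalOf Ω} :
    σ ∈ galFix Ω E ↔ ∀ x : Ω, (x : L) ∈ E → σ x = x := by
  rw [galFix, IntermediateField.mem_fixingSubgroup_iff]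
  rfl

instance (Ω E : IntermediateField K L) [FiniteDimensional K E] :
    FiniteDimensional K (E.comap Ω.val) :=
  FiniteDimensional.of_injective
    (({ toFun := fun x => ⟨((x : Ω) : L), x.2⟩
        map_add' := fun _ _ => rfl
        map_smul' := fun _ _ => rfl } : E.comap Ω.val →ₗ[K] E))
    (fun a b h => by
      have h' : ((a : Ω) : L) = ((b : Ω) : L) := congrArg (fun z : E => (z : L)) h
      exact Subtype.ext (Subtype.ext h'))

lemma isOpen_galFix (Ω E : IntermediateField K L) [FiniteDimensional K E] :
    IsOpen (galFix Ω E : Set (GalOf Ω)) :=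
  (E.comap Ω.val).fixingSubgroup_isOpen

instance (Ω E : IntermediateField K L) [FiniteDimensional K E] (U : Subgroup (GalOf Ω)) :
    Finite (U ⧸ (galFix Ω E).subgroupOf U) := by
  let E' : IntermediateField K Ω := E.comap Ω.val
  let φ : U → (E' →ₐ[K] Ω) := fun σ => ((σ : (GalOf Ω)) : Ω →ₐ[K] Ω).comp E'.val
  have key : ∀ a b : U, φ a = φ b →
      (QuotientGroup.mk a : U ⧸ (galFix Ω E).subgroupOf U) = QuotientGroup.mk b := by
    intro a b hab
    rw [QuotientGroup.eq, Subgroup.mem_subgroupOf, mem_galFix]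
    intro x hx
    have h1 : (a : (GalOf Ω)) x = (b : (GalOf Ω)) x := DFunLike.congr_fun hab ⟨x, hx⟩
    have h2 : ((a⁻¹ * b : U) : (GalOf Ω)) x
        = ((a : (GalOf Ω))⁻¹) ((b : (GalOf Ω)) x) := rfl
    rw [h2, ← h1]
    exact AlgEquiv.symm_apply_apply (a : (GalOf Ω)) x
  refine Finite.of_injective
    (fun c : U ⧸ (galFix Ω E).subgroupOf U => φ (Quotient.out c)) fun c c' h => ?_
  have := key _ _ h
  rwa [QuotientGroup.out_eq', QuotientGroup.out_eq'] at this

end Galois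

/-! ## Fields -/

/-- The field of algebraic numbers, as a subfield of `ℂ`. -/
abbrev Qbar : Type := algebraicClosure ℚ ℂ

instance : Algebra.IsAlgebraic ℚ Qbar := by
  have h : Algebra.IsAlgebraic ℚ (algebraicClosure ℚ ℂ) := algebraicClosure.isAlgebraic ℚ ℂ
  convert h

/-- `ζ_N = exp (2 π i / N)`. -/
def zeta (N : ℕ) : Qbar :=
  ⟨Complex.exp (2 * Real.pi * Complex.I / N), by
    rw [mem_algebraicClosure_iff]
    rcases Nat.eq_zero_or_pos N with rfl | hN
    · simpa using isAlgebraic_one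
    · exact ((Complex.isPrimitiveRoot_exp N hN.ne').isIntegral hN).tower_top.isAlgebraic⟩

lemma zeta_pow_self (N : ℕ) : zeta N ^ N = 1 := by
  apply Subtype.ext
  rcases Nat.eq_zero_or_pos N with rfl | hN
  · simp
  · exact (Complex.isPrimitiveRoot_exp N hN.ne').pow_eq_one

/-- `ζ_N` as an algebraic integer. -/
def zetaInt (N : ℕ) : 𝓞 Qbar :=
  ⟨zeta N, by
    rcases Nat.eq_zero_or_pos N with rfl | hN
    · have : zeta 0 = 1 := Subtype.ext (by simp [zeta])
      rw [this]
      exact one_mem _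
    · exact IsIntegral.of_pow hN (by rw [zeta_pow_self]; exact isIntegral_one)⟩

lemma zeta_pow_of_mul {M N : ℕ} (hM : M ≠ 0) : zeta (M * N) ^ M = zeta N := by
  apply Subtype.ext
  change Complex.exp (2 * Real.pi * Complex.I / (M * N : ℕ)) ^ M
    = Complex.exp (2 * Real.pi * Complex.I / N)
  rw [← Complex.exp_nat_mul]
  congr 1
  have : (M : ℂ) ≠ 0 := by exact_mod_cast hM
  rcases Nat.eq_zero_or_pos N with rfl | hN
  · simp
  · have : (N : ℂ) ≠ 0 := by exact_mod_cast hN.ne'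
    push_cast
    field_simp

/-- The cyclotomic field `ℚ(ζ_N)`. -/
def cyc (N : ℕ) : IntermediateField ℚ Qbar := IntermediateField.adjoin ℚ {zeta N}

lemma zeta_mem_cyc (N : ℕ) : zeta N ∈ cyc N := IntermediateField.mem_adjoin_simple_self ℚ _

lemma cyc_le_cyc {M N : ℕ} (hN : N ≠ 0) (h : M ∣ N) : cyc M ≤ cyc N := by
  obtain ⟨k, rfl⟩ := h
  have hk : k ≠ 0 := right_ne_zero_of_mul hN
  rw [cyc, IntermediateField.adjoin_simple_le_iff, ← zeta_pow_of_mul hk, mul_comm k]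
  exact pow_mem (zeta_mem_cyc _) _

instance (N : ℕ) : FiniteDimensional ℚ (cyc N) := by
  apply IntermediateField.adjoin.finiteDimensional
  exact Algebra.IsIntegral.isIntegral _

/-- The conductor of `F` is `f`: the least positive integer with `F ⊆ ℚ(ζ_f)`. -/
def IsConductor (F : IntermediateField ℚ Qbar) (f : ℕ) : Prop :=
  IsLeast {m : ℕ | 0 < m ∧ F ≤ cyc m} f

variable (p : ℕ) (F : IntermediateField ℚ Qbar)

/-- `F_m = F(ζ_{p^m})`. -/
def layer (m : ℕ) : IntermediateField ℚ Qbar := F ⊔ cyc (p ^ m)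

/-- `Ω_S`: the compositum of all finite extensions of `F` inside `Qbar` which are unramified at
every prime not dividing `p`. -/
def Omega : IntermediateField ℚ Qbar :=
  ⨆ (E : IntermediateField F Qbar) (_ : FiniteDimensional F E)
    (_ : ∀ (P : Ideal (𝓞 E)) [P.IsPrime], (p : 𝓞 E) ∉ P → Algebra.IsUnramifiedAt (𝓞 F) P),
    E.restrictScalars ℚ

/-- `𝒢_S = Gal(Ω_S/ℚ)`, with its Krull topology. -/
abbrev GS : Type := GalOf (Omega p F)

instance [NumberField F] (m : ℕ) : FiniteDimensional ℚ (layer p F m) :=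
  IntermediateField.finiteDimensional_sup _ _

/-! ## Tate twists -/

/-- The `p`-adic cyclotomic character `κ : 𝒢_S → ℤ_pˣ`. -/
def kappa [Fact p.Prime] : GS p F →* ℤ_[p]ˣ :=
  (cyclotomicCharacter (Omega p F) p).comp
    (MulSemiringAction.toRingAut (GS p F) (Omega p F))

/-- `ℤ/p^m(r)`: the group `ℤ/p^m`, with basis `t(r)_m` corresponding to `1`, on which `σ ∈ 𝒢_S`
acts as multiplication by `κ(σ)^r mod p^m`. -/
def twist [Fact p.Prime] (r m : ℕ) : GS p F →* AddMonoid.End (ZMod (p ^ m)) :=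
  (Module.toAddMonoidEnd (ZMod (p ^ m)) (ZMod (p ^ m)) : _ →* _).comp <|
    (powMonoidHom r).comp <| (PadicInt.toZModPow (p := p) m).toMonoidHom.comp <|
      (Units.coeHom ℤ_[p]).comp (kappa p F)

lemma twist_apply [Fact p.Prime] (r m : ℕ) (σ : GS p F) (x : ZMod (p ^ m)) :
    twist p F r m σ x = PadicInt.toZModPow m (kappa p F σ : ℤ_[p]) ^ r * x := rfl

/-- The group `G_S = Gal(Ω_S/F)`. -/
abbrev galS : Subgroup (GS p F) := galFix (Omega p F) F

/-- The group `G_S(F_m) = Gal(Ω_S/F_m)`. -/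
abbrev galSLayer (m : ℕ) : Subgroup (GS p F) := galFix (Omega p F) (layer p F m)

/-- The reduction `H¹(U, ℤ/p^(m+1)(r)) → H¹(U, ℤ/p^m(r))`. -/
def reduction [Fact p.Prime] (r m : ℕ) (U : Subgroup (GS p F)) :
    H1 (twist p F r (m + 1)) U →+ H1 (twist p F r m) U :=
  H1.coeffMap (twist p F r (m + 1)) (twist p F r m)
    (ZMod.castHom (pow_dvd_pow p m.le_succ) (ZMod (p ^ m))).toAddMonoidHom
    (fun σ x => by
      have h : ZMod.castHom (pow_dvd_pow p m.le_succ) (ZMod (p ^ m))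
          (PadicInt.toZModPow (m + 1) (kappa p F σ : ℤ_[p]))
            = PadicInt.toZModPow m (kappa p F σ : ℤ_[p]) := by
        rw [← RingHom.comp_apply, PadicInt.zmod_cast_comp_toZModPow _ _ m.le_succ]
      simp only [twist_apply, RingHom.toAddMonoidHom_eq_coe, AddMonoidHom.coe_coe, map_mul,
        map_pow, h])
    U

/-- `H¹(G_S, ℤ_p(r)) = lim_m H¹(G_S, ℤ/p^m(r))`, as a subgroup of the product. -/
def H1Zp [Fact p.Prime] (r : ℕ) : AddSubgroup (∀ m : ℕ, H1 (twist p F r m) (galS p F)) where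
  carrier := {x | ∀ m, reduction p F r m (galS p F) (x (m + 1)) = x m}
  zero_mem' := fun m => by simp
  add_mem' := fun ha hb m => by simp [ha m, hb m]
  neg_mem' := fun ha m => by simp [ha m]

/-! ## Kummer classes and the special elements -/

/-- `x ∈ H¹(U, ℤ/p^m(r))` is the image of `u ⊗ t(r-1)_m` under the Kummer map: for some `p^m`-th
root `v` of `u` in `Ω_S`, it is the class of the cocycle `σ ↦ (σ(v)/v) ⊗ t(r-1)_m`. Here
`μ_{p^m} ⊗ ℤ/p^m(r-1)` is identified with `ℤ/p^m(r)` through its basis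
`ζ_{p^m} ⊗ t(r-1)_m = t(r)_m`. -/
def IsKummerClass [Fact p.Prime] (r m : ℕ) (U : Subgroup (GS p F)) (u : Qbar)
    (x : H1 (twist p F r m) U) : Prop :=
  u ≠ 0 ∧ ∃ v : Omega p F, (v : Qbar) ^ p ^ m = u ∧
    ∃ f : Z1 (twist p F r m) U,
      (∀ σ : U, ((σ : GS p F) v : Qbar) = zeta (p ^ m) ^ (f.1 σ).val * (v : Qbar)) ∧
      x = H1.mk _ U f

open Classical in
/-- The Kummer class of `u ⊗ t(r-1)_m` in `H¹(U, ℤ/p^m(r))`; it exists and is unique if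
`U = G_S(F_m)` and `u` is a `p`-unit of `F_m`. By convention it is `0` if it does not exist. -/
def kummerClass [Fact p.Prime] (r m : ℕ) (U : Subgroup (GS p F)) (u : Qbar) :
    H1 (twist p F r m) U :=
  if h : ∃ x, IsKummerClass p F r m U u x then h.choose else 0

/-- The `m`-th component of the descent map: for the `m`-th term `u` of a norm coherent sequence,
`α_m (u ⊗ t(r-1)) = cor_{F_m/F} (u ⊗ t(r-1)_m) ∈ H¹(G_S, ℤ/p^m(r))`. -/
def descent [Fact p.Prime] [NumberField F] (r m : ℕ) (u : Qbar) :
    H1 (twist p F r m) (galS p F) :=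
  H1.cor (twist p F r m) (galS p F) (galSLayer p F m) (isOpen_galFix _ _)
    (kummerClass p F r m (galSLayer p F m) u)

/-- The relative norm `N_{K/E}`, for `E ⊆ K` inside `Qbar`. -/
def relNorm {E K : IntermediateField ℚ Qbar} (h : E ≤ K) (x : K) : E :=
  Algebra.norm E (⟨(x : Qbar), x.2⟩ : IntermediateField.extendScalars h)

/-- `N_{ℚ(ζ_{b p^m}) / F_m ∩ ℚ(ζ_{b p^m})} (1 - ζ_{b p^m})`. -/
def cycNorm (b m : ℕ) : (layer p F m ⊓ cyc (b * p ^ m) : IntermediateField ℚ Qbar) :=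
  relNorm inf_le_right ⟨1 - zeta (b * p ^ m), sub_mem (one_mem _) (zeta_mem_cyc _)⟩

lemma layer_le_layer [Fact p.Prime] {m k : ℕ} (h : m ≤ k) : layer p F m ≤ layer p F k :=
  sup_le_sup_left (cyc_le_cyc (pow_ne_zero _ (Fact.out : p.Prime).ne_zero) (pow_dvd_pow p h)) F

/-- The cyclotomic number `ε_{b,m}^F` of `F_m`, where `p^a` is the `p`-part of the conductor of
`F`: it is `N_{ℚ(ζ_{b p^m}) / F_m ∩ ℚ(ζ_{b p^m})} (1 - ζ_{b p^m})` for `m ≥ a`, and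
`N_{F_a/F_m} (ε_{b,a}^F)` for `m < a`. -/
def epsilon [Fact p.Prime] (a b m : ℕ) : Qbar :=
  if h : a ≤ m then (cycNorm p F b m : Qbar)
  else (relNorm (layer_le_layer p F (not_le.1 h).le)
    ⟨(cycNorm p F b a : Qbar), (cycNorm p F b a).2.1⟩ : layer p F m)

/-- The special element `c^F_b(r) = α (ε_{b,∞}^F ⊗ t(r-1))`, given by its components in the
groups `H¹(G_S, ℤ/p^m(r))`. -/
def special [Fact p.Prime] [NumberField F] (a b r : ℕ) :
    ∀ m : ℕ, H1 (twist p F r m) (galS p F) :=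
  fun m => descent p F r m (epsilon p F a b m)

/-! ## Reduction modulo `ℓ` -/

/-- For a prime `𝔏` of the ring of algebraic integers, the decomposition group in
`G_S = Gal(Ω_S/F)` of the prime `𝔏 ∩ Ω_S`. -/
def decomp (𝔏 : Ideal (𝓞 Qbar)) : Subgroup (GS p F) :=
  MulAction.stabilizer (GS p F) (𝔏.comap (algebraMap (𝓞 (Omega p F)) (𝓞 Qbar))) ⊓ galS p F

/-- `x ∈ H¹(D, ℤ/p^n(r))`, with `D` the decomposition group of `𝔏 ∩ Ω_S`, is the image of
`b ⊗ t(r-1)_n ∈ (𝔽_λˣ/p^n)(r-1)`, with `λ = 𝔏 ∩ F` and `𝔽_λ = 𝔽_ℓ`, under the identification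
given by the Kummer cocycle: for some `p^n`-th root `v` of `b` in the residue field of `Ω_S` at
`𝔏 ∩ Ω_S`, it is the class of the cocycle `σ ↦ (σ(v)/v) ⊗ t(r-1)_n`, where `σ(v)/v` is a power of
the reduction of `ζ_{p^n}`. -/
def IsResidueKummerClass [Fact p.Prime] (r n ℓ : ℕ) (𝔏 : Ideal (𝓞 Qbar)) (b : ZMod ℓ)
    (x : H1 (twist p F r n) (decomp p F 𝔏)) : Prop :=
  b ≠ 0 ∧ ∃ v : 𝓞 (Omega p F),
    algebraMap (𝓞 (Omega p F)) (𝓞 Qbar) v ^ p ^ n - (b.val : 𝓞 Qbar) ∈ 𝔏 ∧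
    ∃ f : Z1 (twist p F r n) (decomp p F 𝔏),
      (∀ σ : decomp p F 𝔏,
        algebraMap (𝓞 (Omega p F)) (𝓞 Qbar) ((σ : GS p F) • v)
          - zetaInt (p ^ n) ^ (f.1 σ).val * algebraMap (𝓞 (Omega p F)) (𝓞 Qbar) v ∈ 𝔏) ∧
      x = H1.mk _ _ f

/-- The family of prime ideals `L(λ^g) = τ_g(𝔏)`, `g ∈ G = Gal(F/ℚ)`, where `τ_g ∈ Gal(Qbar/ℚ)`
lifts `g`; it lies over the prime ideals `λ^g = g(λ)` of `F`. -/
def conjPrime (𝔏 : Ideal (𝓞 Qbar)) (τ : GalOf F → Gal(Qbar/ℚ)) (g : GalOf F) :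
    Ideal (𝓞 Qbar) :=
  τ g • 𝔏

/-- The reduction map
`φ_{ℓ,n} : H¹(G_S, ℤ/p^n(r)) → ⨁_{g ∈ G} H¹(D_{L(λ^g)}, ℤ/p^n(r)) = ⨁_{g ∈ G} H¹(𝔽_{λ^g}, ℤ/p^n(r))`,
whose component at `g` is the restriction to the decomposition group of `L(λ^g)`. -/
def phi [Fact p.Prime] (r n : ℕ) (𝔏 : Ideal (𝓞 Qbar)) (τ : GalOf F → Gal(Qbar/ℚ)) :
    H1 (twist p F r n) (galS p F) →+
      ∀ g : GalOf F, H1 (twist p F r n) (decomp p F (conjPrime F 𝔏 τ g)) :=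
  AddMonoidHom.pi fun _ => H1.res (twist p F r n) inf_le_right

/-- `I` is a system of representatives in `ℤ` of `Gal(ℚ(ζ_N)/F)`, seen in `(ℤ/N)ˣ` through
`σ(ζ_N) = ζ_N ^ i`. -/
def IsRepresentativeSystem (N : ℕ) (I : Finset ℤ) : Prop :=
  (∀ i ∈ I, ∃ σ ∈ galFix (cyc N) F, (σ ⟨zeta N, zeta_mem_cyc N⟩ : Qbar) = zeta N ^ i) ∧
  ∀ σ ∈ galFix (cyc N) F, ∃! i : ℤ, i ∈ I ∧ (σ ⟨zeta N, zeta_mem_cyc N⟩ : Qbar) = zeta N ^ i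

end TwistedCyclotomic

/-! Kummer theory at finite level gives both claims. By `epsilon_eq`, ε_m is the product of 1 - z
over the conjugates z of ζ_{d p^max(a,m)} over F_m. For m ≥ 1 it divides a power of p, so its p^m-th
roots lie in Ω_S (`root_mem_Omega`) and its Kummer class exists and is unique
(`exists_isKummerClass`, `IsKummerClass.unique`).

Coherence. Reducing the coefficients of the class x_{m+1} gives the Kummer class of ε_{m+1} at level
p^m. Over F_m the twist is trivial modulo p^m, so the corestriction to F_m is the class of the norm
of ε_{m+1} (`IsKummerClass.cor`). This norm is ε_m, by 1 - x^p = ∏ (1 - ηx) over the p-th roots of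
unity η (`prod_one_sub_galOrbit_mul_prime`). Transitivity of corestriction, `H1.cor_cor`, then
descends to F.

Reduction at ℓ. From F_n to F the twist is not trivial, and the corestricted cocycle is not a Kummer
cocycle on all of G_S. It is one on the elements that fix every coset of G_S(F_n): there it belongs
to w = ∏ s(c)(v)^{κ(s(c))^{r-1}}, where v is a p^n-th root of ε_n and s(c) are coset representatives
(`liftGal_prod_rep`). Since ℓ ≡ 1 mod d p^n, the decomposition groups fix F_n (`decomp_le_galFix`),
and F_n lies in an abelian field, so they do fix every coset. Finally w^{p^n} is ∏ (1 -
ζ^i)^{i^{r-1}} with ζ = ζ_{d p^n} and exponents reduced modulo p^n (`prod_rep_epsilon_pow`), and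
modulo τ_g(𝔏) the root ζ becomes ξ^{a_g(ℓ-1)/(d p^n)} (`isResidueOfZeta_smul`). -/

namespace TwistedCyclotomic

/-! ### Extensions unramified outside p -/

section Unramified

open Polynomial

/-- `E/F` is unramified at all primes not dividing `p`. -/
def UnramifiedOutside (p : ℕ) (F E : Type*) [Field F] [Field E] [Algebra F E] : Prop :=
  ∀ (P : Ideal (𝓞 E)) [P.IsPrime], (p : 𝓞 E) ∉ P → Algebra.IsUnramifiedAt (𝓞 F) P

lemma UnramifiedOutside.trans {p : ℕ} {F E K : Type*} [Field F] [Field E] [Field K]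
    [Algebra F E] [Algebra E K] [Algebra F K] [IsScalarTower F E K]
    (h1 : UnramifiedOutside p F E) (h2 : UnramifiedOutside p E K) : UnramifiedOutside p F K := by
  intro P _ hP
  have : Algebra.IsUnramifiedAt (𝓞 E) P := h2 P hP
  let Q : Ideal (𝓞 E) := P.under (𝓞 E)
  have hQ : (p : 𝓞 E) ∉ Q := by
    intro h
    apply hP
    have := Ideal.mem_comap.1 h
    simpa using this
  have : Algebra.IsUnramifiedAt (𝓞 F) Q := h1 Q hQ
  exact Algebra.IsUnramifiedAt.comp Q P

/-- The minimal polynomial of α divides X^{p^m} - u, so its derivative at α, which lies in the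
different, divides p^m α^{p^m-1}. A prime not containing p contains neither p nor α, hence does not
divide the different. -/
lemma UnramifiedOutside.of_root {p k m : ℕ} {E K : Type*} [Field E] [Field K] [NumberField E]
    [NumberField K] [Algebra E K] (α : 𝓞 K) (u : 𝓞 E) (hα : α ^ p ^ m = algebraMap (𝓞 E) (𝓞 K) u)
    (hu : u ∣ p ^ k) (hp : p ≠ 0) (hK : Algebra.adjoin E {(α : K)} = ⊤) :
    UnramifiedOutside p E K := by
  intro P _ hP
  have hαP : α ∉ P := by
    intro h
    have h1 : algebraMap (𝓞 E) (𝓞 K) u ∣ (p : 𝓞 K) ^ k := by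
      have := map_dvd (algebraMap (𝓞 E) (𝓞 K)) hu
      simpa using this
    rw [← hα] at h1
    exact hP (Ideal.IsPrime.mem_of_pow_mem inferInstance k
      (Ideal.mem_of_dvd _ h1 (Ideal.pow_mem_of_mem _ h _ (Nat.pos_of_ne_zero (pow_ne_zero m hp)))))
  rw [← not_dvd_differentIdeal_iff (A := 𝓞 E)]
  intro hd
  have h1 := aeval_derivative_mem_differentIdeal (𝓞 E) E K α hK
  have h2 : aeval α (derivative (minpoly (𝓞 E) α)) ∈ P := Ideal.dvd_iff_le.1 hd h1
  have h3 : minpoly (𝓞 E) α ∣ X ^ p ^ m - C u := by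
    apply minpoly.isIntegrallyClosed_dvd (Algebra.IsIntegral.isIntegral α)
    simp [hα]
  obtain ⟨q, hq⟩ := h3
  have h4 : aeval α (derivative (X ^ p ^ m - C u)) ∈ P := by
    rw [hq, derivative_mul]
    simp only [map_add, map_mul, minpoly.aeval, zero_mul, add_zero]
    exact Ideal.mul_mem_right _ _ h2
  have h5 : (p : 𝓞 K) ^ m * α ^ (p ^ m - 1) ∈ P := by
    simpa [derivative_X_pow] using h4
  rcases Ideal.IsPrime.mem_or_mem inferInstance h5 with h | h
  · exact hP (Ideal.IsPrime.mem_of_pow_mem inferInstance _ h)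
  · exact hαP (Ideal.IsPrime.mem_of_pow_mem inferInstance _ h)

lemma UnramifiedOutside.of_surjective {p : ℕ} {E K : Type*} [Field E] [Field K]
    [Algebra E K] (h : Function.Surjective (algebraMap E K)) : UnramifiedOutside p E K := by
  intro P _ hP
  have : Function.Surjective (algebraMap (𝓞 E) (𝓞 K)) := by
    intro x
    obtain ⟨y, hy⟩ := h (x : K)
    refine ⟨⟨y, ?_⟩, NumberField.RingOfIntegers.ext hy⟩
    have h' : IsIntegral ℤ (algebraMap E K y) := hy ▸ x.2
    exact (isIntegral_algHom_iff (algebraMap E K).toIntAlgHom (algebraMap E K).injective).1 h'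
  have : Algebra.FormallyUnramified (𝓞 E) (𝓞 K) :=
    Algebra.FormallyUnramified.of_surjective (Algebra.ofId (𝓞 E) (𝓞 K)) this
  exact Algebra.FormallyUnramified.comp (𝓞 E) (𝓞 K) _

lemma UnramifiedOutside.of_algEquiv {p : ℕ} {F E K : Type*} [Field F] [Field E] [Field K]
    [Algebra F E] [Algebra F K] (e : E ≃ₐ[F] K) (h1 : UnramifiedOutside p F E) :
    UnramifiedOutside p F K := by
  algebraize [e.toAlgHom.toRingHom]
  have : IsScalarTower F E K := IsScalarTower.of_algebraMap_eq fun x => (e.commutes x).symm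
  exact h1.trans (UnramifiedOutside.of_surjective e.surjective)

section RestrictScalars

variable {p : ℕ} {F L : Type*} [Field F] [Field L] [Algebra F L]

/-- Restriction of scalars does not change the underlying field. -/
def restrictScalarsEquiv {E : IntermediateField F L} (K : IntermediateField E L) :
    K ≃ₐ[F] K.restrictScalars F where
  toFun x := ⟨x, x.2⟩
  invFun x := ⟨x, x.2⟩
  map_mul' _ _ := rfl
  map_add' _ _ := rfl
  commutes' _ := rfl

lemma UnramifiedOutside.restrictScalars {E : IntermediateField F L}
    (h1 : UnramifiedOutside p F E) (K : IntermediateField E L) (h2 : UnramifiedOutside p E K) :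
    UnramifiedOutside p F (K.restrictScalars F) :=
  (h1.trans h2).of_algEquiv (restrictScalarsEquiv K)

lemma finiteDimensional_restrictScalars {E : IntermediateField F L} [FiniteDimensional F E]
    (K : IntermediateField E L) [FiniteDimensional E K] :
    FiniteDimensional F (K.restrictScalars F) :=
  have : FiniteDimensional F K := FiniteDimensional.trans F E K
  (restrictScalarsEquiv K).toLinearEquiv.finiteDimensional

end RestrictScalars

end Unramified

/-! ### Roots of divisors of powers of p lie in Ω_S -/

/-- `u` is an algebraic integer dividing a power of `p`. -/
def DvdPrimePow (p : ℕ) (u : Qbar) : Prop :=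
  IsIntegral ℤ u ∧ ∃ (k : ℕ) (y : Qbar), IsIntegral ℤ y ∧ u * y = (p : Qbar) ^ k

lemma DvdPrimePow.ne_zero {p : ℕ} {u : Qbar} (hp : p ≠ 0) (hu : DvdPrimePow p u) : u ≠ 0 := by
  obtain ⟨-, k, y, -, h⟩ := hu
  rintro rfl
  rw [zero_mul] at h
  exact pow_ne_zero k (Nat.cast_ne_zero.2 hp) h.symm

lemma DvdPrimePow.one (p : ℕ) : DvdPrimePow p 1 :=
  ⟨isIntegral_one, 0, 1, isIntegral_one, by simp⟩

lemma DvdPrimePow.mul {p : ℕ} {u v : Qbar} (hu : DvdPrimePow p u) (hv : DvdPrimePow p v) :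
    DvdPrimePow p (u * v) := by
  obtain ⟨h1, k, y, hy, h⟩ := hu
  obtain ⟨h2, l, z, hz, h'⟩ := hv
  exact ⟨h1.mul h2, k + l, y * z, hy.mul hz, by rw [pow_add, ← h, ← h']; ring⟩

lemma DvdPrimePow.prod {p : ℕ} {ι : Type*} {s : Finset ι} {u : ι → Qbar}
    (hu : ∀ i ∈ s, DvdPrimePow p (u i)) : DvdPrimePow p (∏ i ∈ s, u i) :=
  Finset.prod_induction _ _ (fun _ _ => DvdPrimePow.mul) (DvdPrimePow.one p) hu

section Omega

variable {p : ℕ} {F : IntermediateField ℚ Qbar}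

lemma le_Omega (E : IntermediateField F Qbar) [FiniteDimensional F E]
    (h : UnramifiedOutside p F E) : E.restrictScalars ℚ ≤ Omega p F := by
  refine le_iSup_of_le E (le_iSup_of_le inferInstance (le_iSup_of_le ?_ le_rfl))
  exact h

lemma unramifiedOutside_adjoin [NumberField F] (hp : p ≠ 0) (E : IntermediateField F Qbar)
    [FiniteDimensional F E] (h : UnramifiedOutside p F E) {m : ℕ} {α : Qbar}
    (hα : α ^ p ^ m ∈ E) (hd : DvdPrimePow p (α ^ p ^ m)) :
    ∃ E' : IntermediateField F Qbar, E ≤ E' ∧ α ∈ E' ∧ FiniteDimensional F E' ∧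
      UnramifiedOutside p F E' := by
  have hαi : IsIntegral ℤ α := IsIntegral.of_pow (Nat.pos_of_ne_zero (pow_ne_zero m hp)) hd.1
  let K : IntermediateField E Qbar := IntermediateField.adjoin E {α}
  have : NumberField E :=
    { to_charZero := inferInstance
      to_finiteDimensional := FiniteDimensional.trans ℚ F E }
  have : FiniteDimensional E K :=
    IntermediateField.adjoin.finiteDimensional (hαi.tower_top)
  have : NumberField K :=
    { to_charZero := inferInstance
      to_finiteDimensional := FiniteDimensional.trans ℚ E K }
  have hmem : α ∈ K := IntermediateField.mem_adjoin_simple_self E α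
  obtain ⟨k, y, hy, hk⟩ := hd.2
  -- The cofactor y is a quotient of elements of E, so the divisibility already holds in the ring of
  -- integers of E.
  have hyE : y ∈ E := by
    have : y = (p : Qbar) ^ k / α ^ p ^ m := by
      rw [eq_div_iff (hd.ne_zero hp), mul_comm, hk]
    rw [this]
    exact div_mem (pow_mem (natCast_mem _ _) _) hα
  have hEi : ∀ x : E, IsIntegral ℤ (x : Qbar) → IsIntegral ℤ x := fun x hx =>
    (isIntegral_algHom_iff ((algebraMap E Qbar).toIntAlgHom) (algebraMap E Qbar).injective).1 hx
  have hKi : ∀ x : K, IsIntegral ℤ (x : Qbar) → IsIntegral ℤ x := fun x hx =>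
    (isIntegral_algHom_iff ((algebraMap K Qbar).toIntAlgHom) (algebraMap K Qbar).injective).1 hx
  have hK : UnramifiedOutside p E K := by
    refine UnramifiedOutside.of_root (k := k) (m := m) ⟨⟨α, hmem⟩, hKi _ hαi⟩
      ⟨⟨α ^ p ^ m, hα⟩, hEi _ hd.1⟩ ?_ ⟨⟨⟨y, hyE⟩, hEi _ hy⟩, ?_⟩ hp ?_
    · apply NumberField.RingOfIntegers.ext
      apply Subtype.ext
      rfl
    · apply NumberField.RingOfIntegers.ext
      apply Subtype.ext
      change (((p ^ k : 𝓞 E) : E) : Qbar) = α ^ p ^ m * y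
      rw [hk]
      simp
    · exact (IntermediateField.adjoin.powerBasis
        (hαi.tower_top : IsIntegral E α)).adjoin_gen_eq_top
  exact ⟨K.restrictScalars F, fun x hx => K.algebraMap_mem ⟨x, hx⟩, hmem,
    finiteDimensional_restrictScalars K, h.restrictScalars K hK⟩

lemma zeta_isPrimitiveRoot {N : ℕ} (hN : N ≠ 0) : IsPrimitiveRoot (zeta N) N := by
  have : IsPrimitiveRoot ((algebraicClosure ℚ ℂ).val (zeta N)) N :=
    Complex.isPrimitiveRoot_exp N hN
  exact this.of_map_of_injective (algebraicClosure ℚ ℂ).val.injective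

/-- ζ_{p^m} is a p^m-th root of the unit 1, so the adjunction lemma applies to it over F. -/
lemma exists_unramifiedOutside_layer [NumberField F] (hp : p ≠ 0) (m : ℕ) :
    ∃ E : IntermediateField F Qbar, layer p F m ≤ E.restrictScalars ℚ ∧ FiniteDimensional F E ∧
      UnramifiedOutside p F E := by
  have hbot : UnramifiedOutside p F (⊥ : IntermediateField F Qbar) := by
    refine UnramifiedOutside.of_surjective fun x => ?_
    obtain ⟨y, hy⟩ := IntermediateField.mem_bot.1 x.2
    exact ⟨y, Subtype.ext hy⟩
  obtain ⟨E, -, h2, h3, h4⟩ := unramifiedOutside_adjoin (m := m) (α := zeta (p ^ m)) hp ⊥ hbot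
    (by rw [zeta_pow_self]; exact one_mem _) (by rw [zeta_pow_self]; exact DvdPrimePow.one p)
  refine ⟨E, sup_le ?_ ?_, h3, h4⟩
  · intro x hx
    exact E.algebraMap_mem ⟨x, hx⟩
  · rw [cyc, IntermediateField.adjoin_simple_le_iff]
    exact h2

lemma layer_le_Omega [NumberField F] (hp : p ≠ 0) (m : ℕ) : layer p F m ≤ Omega p F := by
  obtain ⟨E, h1, h2, h3⟩ := exists_unramifiedOutside_layer (F := F) hp m
  exact h1.trans (le_Omega E h3)

lemma root_mem_Omega [NumberField F] (hp : p ≠ 0) {m k : ℕ} {α : Qbar}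
    (hα : α ^ p ^ k ∈ layer p F m) (hd : DvdPrimePow p (α ^ p ^ k)) : α ∈ Omega p F := by
  obtain ⟨E, h1, h2, h3⟩ := exists_unramifiedOutside_layer (F := F) hp m
  obtain ⟨E', -, h5, h6, h7⟩ := unramifiedOutside_adjoin hp E h3 (h1 hα) hd
  exact le_Omega E' h7 h5

/-- Conjugation over F preserves finiteness and ramification, so it permutes the fields whose
compositum is Ω_S. Hence automorphisms of `Qbar` over F restrict to Ω_S. -/
lemma map_Omega_le (σ : Gal(Qbar/F)) {x : Qbar} (hx : x ∈ Omega p F) : σ x ∈ Omega p F := by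
  let σ' : Qbar →ₐ[ℚ] Qbar := (σ.toAlgHom.restrictScalars ℚ)
  suffices h : Omega p F ≤ (Omega p F).comap σ' from h hx
  refine iSup_le fun E => iSup_le fun _ => iSup_le fun h => ?_
  intro x hx
  have h' : UnramifiedOutside p F (E.map σ.toAlgHom) :=
    UnramifiedOutside.of_algEquiv (IntermediateField.intermediateFieldMap σ E) h
  have : FiniteDimensional F (E.map σ.toAlgHom) :=
    LinearEquiv.finiteDimensional (IntermediateField.intermediateFieldMap σ E).toLinearEquiv
  exact le_Omega _ h' ⟨x, hx, rfl⟩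

end Omega

/-! ### Corestriction of cocycles: change of representatives, transitivity, change of coefficients
-/

section Cosets

variable {Γ : Type*} [Group Γ] {M : Type*} [AddCommGroup M] {ρ : Γ →* AddMonoid.End M}

lemma rep_spec {U V : Subgroup Γ} (c : U ⧸ V.subgroupOf U) :
    (QuotientGroup.mk (rep c) : U ⧸ V.subgroupOf U) = c :=
  QuotientGroup.out_eq' _

lemma mk_eq_mk_iff {U V : Subgroup Γ} {a b : U} :
    (QuotientGroup.mk a : U ⧸ V.subgroupOf U) = QuotientGroup.mk b ↔ (a : Γ)⁻¹ * b ∈ V := by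
  rw [QuotientGroup.eq, Subgroup.mem_subgroupOf]
  rfl

open Classical in
/-- Extension of a function on a subgroup by zero. -/
def extendZero {V : Subgroup Γ} (f : V → M) (x : Γ) : M :=
  if h : x ∈ V then f ⟨x, h⟩ else 0

lemma extendZero_of_mem {V : Subgroup Γ} (f : V → M) {x : Γ} (h : x ∈ V) :
    extendZero f x = f ⟨x, h⟩ := dif_pos h

/-- With the extension by zero, the argument of f is a plain group element and can be rewritten
without carrying a membership proof. -/
lemma corFun_eq {U V : Subgroup Γ} [Fintype (U ⧸ V.subgroupOf U)] (f : V → M) (g : U) :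
    corFun ρ f g = ∑ c : U ⧸ V.subgroupOf U, ρ (rep (g • c) : U)
      (extendZero f (((rep (g • c) : U) : Γ)⁻¹ * g * (rep c : U))) := by
  refine Finset.sum_congr rfl fun c _ => ?_
  exact congrArg (ρ _) (extendZero_of_mem f (rep_mem g c)).symm

end Cosets

section Cohomology

variable {Γ : Type*} [Group Γ] [TopologicalSpace Γ]
variable {M : Type*} [AddCommGroup M] {ρ : Γ →* AddMonoid.End M}

lemma H1.mk_eq_mk {U : Subgroup Γ} {f g : Z1 ρ U} :
    H1.mk ρ U f = H1.mk ρ U g ↔ ∃ m : M, ∀ x : U, g.1 x = f.1 x + (ρ (x : Γ) m - m) := by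
  have h : H1.mk ρ U f = H1.mk ρ U g ↔ -f + g ∈ (B1 ρ U).addSubgroupOf (Z1 ρ U) :=
    QuotientAddGroup.eq
  rw [h]
  refine exists_congr fun m => forall_congr' fun x => ?_
  change -f.1 x + g.1 x = _ ↔ _
  rw [neg_add_eq_iff_eq_add]

lemma H1.mk_surjective {U : Subgroup Γ} (x : H1 ρ U) : ∃ f, H1.mk ρ U f = x :=
  QuotientAddGroup.mk'_surjective _ x

lemma extendZero_mul {V : Subgroup Γ} {f : V → M} (hf : f ∈ Z1 ρ V) {x y : Γ} (hx : x ∈ V)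
    (hy : y ∈ V) : extendZero f (x * y) = extendZero f x + ρ x (extendZero f y) := by
  rw [extendZero_of_mem f hx, extendZero_of_mem f hy, extendZero_of_mem f (mul_mem hx hy)]
  exact hf.2 ⟨x, hx⟩ ⟨y, hy⟩

/-- The class of the corestriction does not depend on the choice of representatives. -/
lemma exists_sum_eq_corFun_add {U V : Subgroup Γ} [Fintype (U ⧸ V.subgroupOf U)] {f : V → M}
    (hf : f ∈ Z1 ρ V) {ι : Type*} [Fintype ι] (s : ι → U)
    (hs : Function.Bijective fun i => (QuotientGroup.mk (s i) : U ⧸ V.subgroupOf U))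
    (π : U → ι → ι)
    (hπ : ∀ g i, (QuotientGroup.mk (s (π g i)) : U ⧸ V.subgroupOf U)
      = g • (QuotientGroup.mk (s i) : U ⧸ V.subgroupOf U)) :
    ∃ m : M, ∀ g : U,
      ∑ i, ρ (s (π g i)) (extendZero f (((s (π g i) : U) : Γ)⁻¹ * g * (s i : U)))
        = corFun ρ f g + (ρ (g : Γ) m - m) := by
  let e : ι ≃ U ⧸ V.subgroupOf U := Equiv.ofBijective _ hs
  have he : ∀ i, e i = QuotientGroup.mk (s i) := fun _ => rfl
  let r : ι → Γ := fun i => ((rep (e i) : U) : Γ)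
  let w : ι → Γ := fun i => (r i)⁻¹ * s i
  have hw : ∀ i, w i ∈ V := fun i => mk_eq_mk_iff.1 ((rep_spec (e i)).trans (he i))
  have heπ : ∀ g i, e (π g i) = g • e i := hπ
  -- Writing s i = r i * w i with w i ∈ V, the cocycle relation makes the two sums differ by the
  -- coboundary of this element.
  refine ⟨∑ i, ρ (r i) (extendZero f (w i)), fun g => ?_⟩
  have hx : ∀ i, (r (π g i))⁻¹ * g * r i ∈ V := by
    intro i
    have := rep_mem g (e i)
    rw [← heπ] at this
    exact this
  have key : ∀ i, ρ (s (π g i)) (extendZero f (((s (π g i) : U) : Γ)⁻¹ * g * (s i : U)))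
      = ρ (r (π g i)) (extendZero f ((r (π g i))⁻¹ * g * r i))
        + (ρ (g : Γ) (ρ (r i) (extendZero f (w i)))
          - ρ (r (π g i)) (extendZero f (w (π g i)))) := by
    intro i
    set j := π g i
    have h1 : ((s j : U) : Γ)⁻¹ * g * (s i : U) = (w j)⁻¹ * ((r j)⁻¹ * g * r i * w i) := by
      simp only [w]; group
    have h2 : extendZero f ((r j)⁻¹ * g * r i * w i)
        = extendZero f (w j) + ρ (w j) (extendZero f ((w j)⁻¹ * ((r j)⁻¹ * g * r i * w i))) := by
      rw [← extendZero_mul hf (hw j) (mul_mem (inv_mem (hw j)) (mul_mem (hx i) (hw i)))]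
      rw [mul_inv_cancel_left]
    rw [extendZero_mul hf (hx i) (hw i), ← h1] at h2
    have h3 : ρ (s j) = ρ (r j) * ρ (w j) := by
      rw [← map_mul]; congr 1; simp only [w]; group
    have h4 : ρ (g : Γ) (ρ (r i) (extendZero f (w i)))
        = ρ (r j) (ρ ((r j)⁻¹ * g * r i) (extendZero f (w i))) := by
      change (ρ (g : Γ) * ρ (r i)) _ = (ρ (r j) * ρ ((r j)⁻¹ * g * r i)) _
      rw [← map_mul, ← map_mul]
      congr 2
      group
    have h5 := congrArg (ρ (r j)) h2
    rw [map_add, map_add] at h5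
    rw [h3, h4]
    change ρ (r j) (ρ (w j) _) = _
    rw [← add_sub_assoc, h5]
    abel
  rw [Finset.sum_congr rfl fun i _ => key i, Finset.sum_add_distrib, Finset.sum_sub_distrib,
    corFun_eq, map_sum]
  have hπb : Function.Bijective (π g) := by
    have : π g = e.symm ∘ (fun c => g • c) ∘ e := by
      funext i
      simp [← heπ]
    rw [this]
    exact e.symm.bijective.comp ((MulAction.bijective g).comp e.bijective)
  congr 1
  · refine Fintype.sum_equiv e _ _ fun i => ?_
    rw [← heπ]
  · congr 1
    exact Fintype.sum_bijective _ hπb _ _ fun i => rfl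

variable [IsTopologicalGroup Γ]

lemma H1.cor_mk (U V : Subgroup Γ) [Finite (U ⧸ V.subgroupOf U)] (hV : IsOpen (V : Set Γ))
    (f : Z1 ρ V) : letI := Fintype.ofFinite (U ⧸ V.subgroupOf U)
    H1.cor ρ U V hV (H1.mk ρ V f) = H1.mk ρ U ⟨corFun ρ f.1, corFun_mem_Z1 hV f.2⟩ := rfl

/-- Transitivity of the corestriction. -/
lemma H1.cor_cor {U V W : Subgroup Γ} (hVU : V ≤ U) (hWV : W ≤ V)
    [Finite (U ⧸ V.subgroupOf U)] [Finite (V ⧸ W.subgroupOf V)] [Finite (U ⧸ W.subgroupOf U)]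
    (hV : IsOpen (V : Set Γ)) (hW : IsOpen (W : Set Γ)) (x : H1 ρ W) :
    H1.cor ρ U V hV (H1.cor ρ V W hW x) = H1.cor ρ U W hW x := by
  let _ := Fintype.ofFinite (U ⧸ V.subgroupOf U)
  let _ := Fintype.ofFinite (V ⧸ W.subgroupOf V)
  let _ := Fintype.ofFinite (U ⧸ W.subgroupOf U)
  obtain ⟨f, rfl⟩ := H1.mk_surjective x
  rw [H1.cor_mk, H1.cor_mk, H1.cor_mk, eq_comm, H1.mk_eq_mk]
  -- The products of representatives of U/V and V/W represent U/W. For this choice the double sum is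
  -- literally the iterated corestriction, and π is the induced action of U on index pairs.
  let s : (U ⧸ V.subgroupOf U) × (V ⧸ W.subgroupOf V) → U := fun i =>
    rep i.1 * ⟨(rep i.2 : V), hVU (rep i.2).2⟩
  let π : U → (U ⧸ V.subgroupOf U) × (V ⧸ W.subgroupOf V) →
      (U ⧸ V.subgroupOf U) × (V ⧸ W.subgroupOf V) := fun g i =>
    (g • i.1, (⟨((rep (g • i.1))⁻¹ * g * rep i.1 : U), rep_mem g i.1⟩ : V) • i.2)
  have hs : Function.Bijective fun i => (QuotientGroup.mk (s i) : U ⧸ W.subgroupOf U) := by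
    constructor
    · rintro ⟨c, d⟩ ⟨c', d'⟩ h
      have h1 := mk_eq_mk_iff.1 h
      have hc : c = c' := by
        rw [← rep_spec c, ← rep_spec c', mk_eq_mk_iff]
        have : ((rep c : U) : Γ)⁻¹ * (rep c' : U)
            = (rep d : V) * (((s (c, d) : U) : Γ)⁻¹ * (s (c', d') : U)) * ((rep d' : V) : Γ)⁻¹ := by
          simp only [s, Subgroup.coe_mul]
          group
        rw [this]
        exact mul_mem (mul_mem (rep d).2 (hWV h1)) (inv_mem (rep d').2)
      subst hc
      congr 1
      rw [← rep_spec d, ← rep_spec d', mk_eq_mk_iff]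
      convert h1 using 1
      simp only [s, Subgroup.coe_mul]
      group
    · intro q
      obtain ⟨g, rfl⟩ := QuotientGroup.mk_surjective q
      let c : U ⧸ V.subgroupOf U := QuotientGroup.mk g
      have hv : ((rep c : U) : Γ)⁻¹ * g ∈ V := mk_eq_mk_iff.1 (rep_spec c)
      let d : V ⧸ W.subgroupOf V := QuotientGroup.mk ⟨_, hv⟩
      refine ⟨(c, d), mk_eq_mk_iff.2 ?_⟩
      have := mk_eq_mk_iff.1 (rep_spec d)
      convert this using 1
      simp only [s, Subgroup.coe_mul]
      group
  have hπ : ∀ g i, (QuotientGroup.mk (s (π g i)) : U ⧸ W.subgroupOf U)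
      = g • (QuotientGroup.mk (s i) : U ⧸ W.subgroupOf U) := by
    rintro g ⟨c, d⟩
    change _ = QuotientGroup.mk (g * s (c, d))
    rw [mk_eq_mk_iff]
    have := rep_mem (⟨((rep (g • c))⁻¹ * g * rep c : U), rep_mem g c⟩ : V) d
    convert this using 1
    simp only [s, π, Subgroup.coe_mul, Subgroup.coe_inv]
    group
  obtain ⟨m, hm⟩ := exists_sum_eq_corFun_add f.2 s hs π hπ
  refine ⟨m, fun g => ?_⟩
  rw [← hm]
  change corFun ρ (corFun ρ f.1) g = _
  rw [Fintype.sum_prod_type]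
  unfold corFun
  refine Finset.sum_congr rfl fun c _ => ?_
  rw [map_sum]
  refine Finset.sum_congr rfl fun d _ => ?_
  have hx := rep_mem (⟨((rep (g • c))⁻¹ * g * rep c : U), rep_mem g c⟩ : V) d
  have h1 : ((s (π g (c, d)) : U) : Γ)⁻¹ * g * (s (c, d) : U)
      = ((rep ((⟨((rep (g • c))⁻¹ * g * rep c : U), rep_mem g c⟩ : V) • d))⁻¹
        * (⟨((rep (g • c))⁻¹ * g * rep c : U), rep_mem g c⟩ : V) * rep d : V) := by
    simp only [s, π, Subgroup.coe_mul, Subgroup.coe_inv]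
    group
  rw [h1, extendZero_of_mem f.1 hx]
  change (ρ _ * ρ _) _ = _
  rw [← map_mul]
  rfl

lemma H1.coeffMap_cor {M' : Type*} [AddCommGroup M'] {ρ' : Γ →* AddMonoid.End M'} (φ : M →+ M')
    (hφ : ∀ g m, φ (ρ g m) = ρ' g (φ m)) (U V : Subgroup Γ) [Finite (U ⧸ V.subgroupOf U)]
    (hV : IsOpen (V : Set Γ)) (x : H1 ρ V) :
    H1.coeffMap ρ ρ' φ hφ U (H1.cor ρ U V hV x)
      = H1.cor ρ' U V hV (H1.coeffMap ρ ρ' φ hφ V x) := by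
  let _ := Fintype.ofFinite (U ⧸ V.subgroupOf U)
  obtain ⟨f, rfl⟩ := H1.mk_surjective x
  refine congrArg (H1.mk ρ' U) (Subtype.ext (funext fun g => ?_))
  change φ (corFun ρ f.1 g) = corFun ρ' (fun v => φ (f.1 v)) g
  simp only [corFun, map_sum, hφ]

end Cohomology

/-! ### Norms as products over Galois orbits -/

section GaloisOrbit

universe u

variable {k : Type*} {L : Type u} [Field k] [Field L] [Algebra k L]

lemma apply_eq_of_mem_adjoin {x y : L} {σ τ : Gal(L/k)} (h : σ x = τ x)
    (hy : y ∈ IntermediateField.adjoin k {x}) : σ y = τ y := by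
  induction hy using IntermediateField.adjoin_induction with
  | mem z hz => rw [Set.mem_singleton_iff.1 hz, h]
  | algebraMap z => rw [AlgEquiv.commutes, AlgEquiv.commutes]
  | add a b _ _ ha hb => rw [map_add, map_add, ha, hb]
  | mul a b _ _ ha hb => rw [map_mul, map_mul, ha, hb]
  | inv a _ ha => rw [map_inv₀, map_inv₀, ha]

/-- `ρ` is a system of representatives of `Gal(L/E)` modulo `Gal(L/K)`. -/
def IsCosetSystem (E K : IntermediateField k L) {ι : Type*} (ρ : ι → Gal(L/k)) : Prop :=
  (∀ i, ρ i ∈ E.fixingSubgroup) ∧ ∀ σ ∈ E.fixingSubgroup, ∃! i, ∀ y ∈ K, σ y = ρ i y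

variable [Algebra.IsAlgebraic k L]

/-- The conjugates of `x` under `Gal(L/E)`. -/
def galOrbit (E : IntermediateField k L) (x : L) : Finset L :=
  Set.Finite.toFinset (s := {z | ∃ σ ∈ E.fixingSubgroup, σ x = z}) <| by
    refine Set.Finite.subset (Polynomial.rootSet_finite (minpoly k x) L) ?_
    rintro _ ⟨σ, -, rfl⟩
    rw [Polynomial.mem_rootSet]
    exact ⟨minpoly.ne_zero (Algebra.IsIntegral.isIntegral x),
      minpoly.aeval_algHom k σ.toAlgHom x⟩

lemma mem_galOrbit {E : IntermediateField k L} {x z : L} :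
    z ∈ galOrbit E x ↔ ∃ σ ∈ E.fixingSubgroup, σ x = z := by
  simp [galOrbit]

/-- The E-orbit of x is the union of the translates by ρ i of its K-orbit. The translates are
disjoint: an automorphism is determined on K ⊆ k(x) by its value at x, and distinct ρ i differ on K.
-/
lemma IsCosetSystem.prod_galOrbit {E K : IntermediateField k L} (hEK : E ≤ K) {x : L}
    (hK : K ≤ IntermediateField.adjoin k {x}) {ι : Type*} [Fintype ι] {ρ : ι → Gal(L/k)}
    (hρ : IsCosetSystem E K ρ) {M : Type*} [CommMonoid M] (g : L → M) :
    ∏ i, ∏ z ∈ galOrbit K x, g (ρ i z) = ∏ z ∈ galOrbit E x, g z := by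
  classical
  have h : galOrbit E x = Finset.univ.biUnion fun i => (galOrbit K x).image (ρ i) := by
    ext z
    simp only [Finset.mem_biUnion, Finset.mem_univ, true_and, Finset.mem_image, mem_galOrbit]
    constructor
    · rintro ⟨σ, hσ, rfl⟩
      obtain ⟨i, hi, -⟩ := hρ.2 σ hσ
      refine ⟨i, (ρ i)⁻¹ (σ x), ⟨(ρ i)⁻¹ * σ, ?_, rfl⟩, ?_⟩
      · rw [IntermediateField.mem_fixingSubgroup_iff]
        intro y hy
        rw [AlgEquiv.mul_apply, hi y hy]
        exact AlgEquiv.symm_apply_apply (ρ i) y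
      · exact AlgEquiv.apply_symm_apply (ρ i) _
    · rintro ⟨i, _, ⟨σ, hσ, rfl⟩, rfl⟩
      refine ⟨ρ i * σ, mul_mem (hρ.1 i) ?_, rfl⟩
      exact IntermediateField.fixingSubgroup_antitone hEK hσ
  rw [h, Finset.prod_biUnion]
  · refine Finset.prod_congr rfl fun i _ => ?_
    rw [Finset.prod_image fun a _ b _ hab => (ρ i).injective hab]
  · intro i _ j _ hij
    rw [Function.onFun, Finset.disjoint_left]
    intro z hz hz'
    apply hij
    simp only [Finset.mem_image, mem_galOrbit] at hz hz'
    obtain ⟨_, ⟨σ, hσ, rfl⟩, rfl⟩ := hz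
    obtain ⟨_, ⟨τ, hτ, rfl⟩, hz'⟩ := hz'
    refine (hρ.2 (ρ i) (hρ.1 i)).unique (fun y _ => rfl) fun y hy => ?_
    have h1 : (ρ j * τ) y = (ρ i * σ) y := apply_eq_of_mem_adjoin hz' (hK hy)
    rw [AlgEquiv.mul_apply, AlgEquiv.mul_apply,
      (IntermediateField.mem_fixingSubgroup_iff _ _).1 hσ y hy,
      (IntermediateField.mem_fixingSubgroup_iff _ _).1 hτ y hy] at h1
    exact h1.symm

lemma galOrbit_adjoin (x : L) : galOrbit (IntermediateField.adjoin k {x}) x = {x} := by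
  ext z
  rw [mem_galOrbit, Finset.mem_singleton]
  constructor
  · rintro ⟨σ, hσ, rfl⟩
    exact (IntermediateField.mem_fixingSubgroup_iff _ _).1 hσ x
      (IntermediateField.mem_adjoin_simple_self k x)
  · rintro rfl
    exact ⟨1, one_mem _, rfl⟩

lemma smul_galOrbit {E : IntermediateField k L} {x : L} {σ : Gal(L/k)}
    (hσ : σ ∈ E.fixingSubgroup) {M : Type*} [CommMonoid M] (g : L → M) :
    ∏ z ∈ galOrbit E x, g (σ z) = ∏ z ∈ galOrbit E x, g z := by
  refine Finset.prod_bij' (fun z _ => σ z) (fun z _ => σ⁻¹ z) ?_ ?_ ?_ ?_ ?_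
  · intro z hz
    obtain ⟨τ, hτ, rfl⟩ := mem_galOrbit.1 hz
    exact mem_galOrbit.2 ⟨σ * τ, mul_mem hσ hτ, rfl⟩
  · intro z hz
    obtain ⟨τ, hτ, rfl⟩ := mem_galOrbit.1 hz
    exact mem_galOrbit.2 ⟨σ⁻¹ * τ, mul_mem (inv_mem hσ) hτ, rfl⟩
  · exact fun z _ => AlgEquiv.symm_apply_apply σ z
  · exact fun z _ => AlgEquiv.apply_symm_apply σ z
  · exact fun _ _ => rfl

/-- The relative norm as a product over a system of representatives of the Galois group. -/
lemma exists_isCosetSystem_norm [CharZero k] [IsAlgClosed L] {E K : IntermediateField k L}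
    (h : E ≤ K) [FiniteDimensional k K] :
    ∃ (ι : Type u) (_ : Fintype ι) (ρ : ι → Gal(L/k)), IsCosetSystem E K ρ ∧
      ∀ (y : L) (hy : y ∈ K),
        (Algebra.norm E (⟨y, hy⟩ : IntermediateField.extendScalars h) : L) = ∏ i, ρ i y := by
  let K' : IntermediateField E L := IntermediateField.extendScalars h
  have : FiniteDimensional k K' := inferInstanceAs (FiniteDimensional k K)
  have : IsScalarTower k E K' := IsScalarTower.of_algebraMap_eq fun _ => rfl
  have : FiniteDimensional E K' := FiniteDimensional.right k E K'
  have : Algebra.IsAlgebraic E L := Algebra.IsAlgebraic.tower_top (K := k) E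
  have : IsAlgClosure E L := ⟨inferInstance, inferInstance⟩
  have : Normal E L := IsAlgClosure.normal E L
  have : CharZero E := charZero_of_injective_algebraMap (algebraMap k E).injective
  -- The representatives are extensions to L of the E-embeddings of K, over which the norm is a
  -- product.
  let ρ : (K' →ₐ[E] L) → Gal(L/k) := fun φ =>
    (AlgEquiv.ofBijective (φ.liftNormal L)
      (Algebra.IsAlgebraic.algHom_bijective _)).restrictScalars k
  have hρ : ∀ φ (y : K'), ρ φ y = φ y := fun φ y => φ.liftNormal_commutes L y
  refine ⟨K' →ₐ[E] L, inferInstance, ρ, ⟨fun φ => ?_, fun σ hσ => ?_⟩, fun y hy => ?_⟩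
  · rw [IntermediateField.mem_fixingSubgroup_iff]
    intro x hx
    exact (AlgEquiv.ofBijective (φ.liftNormal L)
      (Algebra.IsAlgebraic.algHom_bijective _)).commutes ⟨x, hx⟩
  · let φ : K' →ₐ[E] L :=
      { (σ : L →+* L).comp (algebraMap K' L) with
        commutes' := fun x => (IntermediateField.mem_fixingSubgroup_iff _ _).1 hσ x x.2 }
    refine ⟨φ, fun y hy => (hρ φ ⟨y, hy⟩).symm, fun ψ hψ => ?_⟩
    ext y
    rw [← hρ ψ y, ← hψ y y.2]
    rfl
  · have := Algebra.norm_eq_prod_embeddings E L (⟨y, hy⟩ : K')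
    refine this.trans (Finset.prod_congr rfl fun φ _ => ?_)
    rw [hρ φ ⟨y, hy⟩]

end GaloisOrbit

instance : IsAlgClosed Qbar := (algebraicClosure.isAlgClosure ℚ ℂ).isAlgClosed

instance : IsAlgClosure ℚ Qbar := ⟨inferInstance, inferInstance⟩

instance : Normal ℚ Qbar := IsAlgClosure.normal ℚ Qbar

instance : IsGalois ℚ Qbar := ⟨⟩

/-! ### The cyclotomic numbers ε_m and their norm relation -/

section CyclotomicNumbers

lemma exists_gal_apply_zeta {N j : ℕ} (hN : N ≠ 0) (hj : j.Coprime N) :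
    ∃ σ : Gal(Qbar/ℚ), σ (zeta N) = zeta N ^ j := by
  have h1 := zeta_isPrimitiveRoot hN
  rw [← isConjRoot_iff_exists_algEquiv, IsConjRoot,
    ← Polynomial.cyclotomic_eq_minpoly_rat h1 (Nat.pos_of_ne_zero hN),
    ← Polynomial.cyclotomic_eq_minpoly_rat (h1.pow_of_coprime j hj) (Nat.pos_of_ne_zero hN)]

lemma exists_apply_zeta_eq_pow {N : ℕ} (hN : N ≠ 0) (σ : Gal(Qbar/ℚ)) :
    ∃ j : ℕ, j.Coprime N ∧ σ (zeta N) = zeta N ^ j := by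
  have : NeZero N := ⟨hN⟩
  have h1 := zeta_isPrimitiveRoot hN
  have h2 : IsPrimitiveRoot (σ (zeta N)) N := h1.map_of_injective σ.injective
  obtain ⟨j, -, hj, h⟩ := (h1.isPrimitiveRoot_iff).1 h2
  exact ⟨j, hj, h.symm⟩

lemma apply_eq_of_mem_cyc {N : ℕ} {σ τ : Gal(Qbar/ℚ)} (h : σ (zeta N) = τ (zeta N)) {x : Qbar}
    (hx : x ∈ cyc N) : σ x = τ x :=
  apply_eq_of_mem_adjoin h hx

lemma isPrimitiveRoot_of_mem_galOrbit {E : IntermediateField ℚ Qbar} {N : ℕ} (hN : N ≠ 0)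
    {z : Qbar} (hz : z ∈ galOrbit E (zeta N)) : IsPrimitiveRoot z N := by
  obtain ⟨σ, -, rfl⟩ := mem_galOrbit.1 hz
  exact (zeta_isPrimitiveRoot hN).map_of_injective σ.injective

/-- The p-th power maps the orbit of ζ_{pN} to that of ζ_N. The fibre over x^p consists of all ηx
with η^p = 1, and the product of 1 - ηx over it is 1 - x^p. -/
lemma prod_one_sub_galOrbit_mul_prime {E : IntermediateField ℚ Qbar} {N p : ℕ} (hp : p.Prime)
    (hN : N ≠ 0) (hpN : p ∣ N) (hE : E ≤ cyc N) :
    ∏ z ∈ galOrbit E (zeta (p * N)), (1 - z) = ∏ z ∈ galOrbit E (zeta N), (1 - z) := by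
  classical
  have hpow : zeta (p * N) ^ p = zeta N := zeta_pow_of_mul hp.ne_zero
  have hNp : p * N ≠ 0 := mul_ne_zero hp.ne_zero hN
  have : NeZero p := ⟨hp.ne_zero⟩
  have hprim := zeta_isPrimitiveRoot hNp
  have hη : IsPrimitiveRoot (zeta (p * N) ^ N) p :=
    hprim.pow (Nat.pos_of_ne_zero hNp) (mul_comm p N)
  have hmaps : ∀ z ∈ galOrbit E (zeta (p * N)), z ^ p ∈ galOrbit E (zeta N) := by
    intro z hz
    obtain ⟨σ, hσ, rfl⟩ := mem_galOrbit.1 hz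
    exact mem_galOrbit.2 ⟨σ, hσ, by rw [← map_pow, hpow]⟩
  rw [← Finset.prod_fiberwise_of_maps_to hmaps]
  refine Finset.prod_congr rfl fun w hw => ?_
  obtain ⟨σ, hσ, rfl⟩ := mem_galOrbit.1 hw
  set x := σ (zeta (p * N)) with hx
  have hxp : x ^ p = σ (zeta N) := by rw [hx, ← map_pow, hpow]
  have hx0 : x ≠ 0 := by
    rw [hx]
    exact (map_ne_zero σ).2 (hprim.ne_zero hNp)
  have h1 := hη.pow_sub_pow_eq_prod_sub_mul 1 x hp.pos
  rw [one_pow, hxp] at h1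
  rw [h1]
  refine Finset.prod_bij' (fun z _ => z / x) (fun η _ => η * x) ?_ ?_ ?_ ?_ ?_
  · intro z hz
    rw [Polynomial.mem_nthRootsFinset hp.pos, div_pow, (Finset.mem_filter.1 hz).2, hxp, div_self]
    rw [← hxp]
    exact pow_ne_zero _ hx0
  · intro η hη'
    rw [Polynomial.mem_nthRootsFinset hp.pos] at hη'
    rw [Finset.mem_filter, mul_pow, hη', one_mul, hxp]
    refine ⟨?_, rfl⟩
    have h2 : (σ⁻¹ η) ^ p = 1 := by rw [← map_pow, hη', map_one]
    obtain ⟨i, -, hi⟩ := hη.eq_pow_of_pow_eq_one h2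
    -- Since p divides N, 1 + N i is also prime to p. The automorphism ζ_{pN} ↦ ζ_{pN}^{1+Ni}
    -- multiplies ζ_{pN} by the prescribed p-th root of unity and fixes ζ_N, hence E.
    have hcop : (1 + N * i).Coprime (p * N) := by
      have : (1 + N * i).Coprime N := by simp
      exact Nat.Coprime.mul_right (Nat.Coprime.coprime_dvd_right hpN this) this
    obtain ⟨τ, hτ⟩ := exists_gal_apply_zeta hNp hcop
    have hτ' : τ (zeta (p * N)) = σ⁻¹ η * zeta (p * N) := by
      rw [hτ, ← hi, ← pow_mul, pow_add, pow_one, mul_comm]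
    refine mem_galOrbit.2 ⟨σ * τ, mul_mem hσ ?_, ?_⟩
    · rw [IntermediateField.mem_fixingSubgroup_iff]
      intro y hy
      refine apply_eq_of_mem_cyc (τ := 1) ?_ (hE hy)
      rw [← hpow, map_pow, hτ', mul_pow, h2, one_mul]
      rfl
    · rw [AlgEquiv.mul_apply, hτ', map_mul]
      congr 1
      exact AlgEquiv.apply_symm_apply σ η
  · intro z _
    exact div_mul_cancel₀ z hx0
  · intro η _
    exact mul_div_cancel_right₀ η hx0
  · intro z _
    rw [div_mul_cancel₀ z hx0]

lemma dvdPrimePow_one_sub {p N : ℕ} (hp : p.Prime) (hN : N ≠ 0) (hpN : p ∣ N) {z : Qbar}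
    (hz : IsPrimitiveRoot z N) : DvdPrimePow p (1 - z) := by
  have hzi : IsIntegral ℤ z := hz.isIntegral (Nat.pos_of_ne_zero hN)
  obtain ⟨M, rfl⟩ := hpN
  have hη : IsPrimitiveRoot (z ^ M) p := hz.pow (Nat.pos_of_ne_zero hN) (mul_comm _ _)
  -- With η = z^M of order p, the sum of 1 - η^i over i < p equals p, and each term is a geometric
  -- sum times 1 - z.
  refine ⟨isIntegral_one.sub hzi, 1,
    ∑ i ∈ Finset.range p, ∑ j ∈ Finset.range (M * i), z ^ j, ?_, ?_⟩
  · exact IsIntegral.sum _ fun i _ => IsIntegral.sum _ fun j _ => hzi.pow j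
  · rw [Finset.mul_sum, pow_one]
    have h1 : ∀ i ∈ Finset.range p, (1 - z) * ∑ j ∈ Finset.range (M * i), z ^ j
        = 1 - (z ^ M) ^ i := by
      intro i _
      rw [mul_neg_geom_sum, pow_mul]
    rw [Finset.sum_congr rfl h1, Finset.sum_sub_distrib, hη.geom_sum_eq_zero hp.one_lt]
    simp

variable {p : ℕ} [Fact p.Prime] {F : IntermediateField ℚ Qbar} {d a : ℕ}

lemma layer_le_cyc (hd : d ≠ 0) (hF : F ≤ cyc (d * p ^ a)) {m M : ℕ} (ha : a ≤ M) (hm : m ≤ M) :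
    layer p F m ≤ cyc (d * p ^ M) := by
  have h0 : d * p ^ M ≠ 0 := mul_ne_zero hd (pow_ne_zero _ (Fact.out : p.Prime).ne_zero)
  exact sup_le (hF.trans (cyc_le_cyc h0 (mul_dvd_mul_left d (pow_dvd_pow p ha))))
    (cyc_le_cyc h0 ((pow_dvd_pow p hm).mul_left d))

lemma cycNorm_eq (hd : d ≠ 0) (hF : F ≤ cyc (d * p ^ a)) {m : ℕ} (ha : a ≤ m) :
    (cycNorm p F d m : Qbar)
      = ∏ z ∈ galOrbit (layer p F m) (zeta (d * p ^ m)), (1 - z) := by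
  have hle : layer p F m ≤ cyc (d * p ^ m) := layer_le_cyc hd hF ha le_rfl
  obtain ⟨ι, _, ρ, hρ, h⟩ := exists_isCosetSystem_norm
    (inf_le_right : layer p F m ⊓ cyc (d * p ^ m) ≤ cyc (d * p ^ m))
  have h1 : ∏ i, ∏ z ∈ galOrbit (cyc (d * p ^ m)) (zeta (d * p ^ m)), (1 - ρ i z)
      = ∏ z ∈ galOrbit (layer p F m ⊓ cyc (d * p ^ m)) (zeta (d * p ^ m)), (1 - z) :=
    hρ.prod_galOrbit inf_le_right le_rfl (fun z => 1 - z)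
  have h2 := h (1 - zeta (d * p ^ m)) (sub_mem (one_mem _) (zeta_mem_cyc _))
  refine Eq.trans h2 ?_
  rw [inf_eq_left.2 hle] at h1
  rw [← h1]
  refine Finset.prod_congr rfl fun i _ => ?_
  have h3 : galOrbit (cyc (d * p ^ m)) (zeta (d * p ^ m)) = {zeta (d * p ^ m)} :=
    galOrbit_adjoin _
  rw [h3, Finset.prod_singleton, map_sub, map_one]

/-- A single formula for both cases of the definition: for m < a, the norm from F_a to F_m enlarges
the orbit of the same root of unity. -/
lemma epsilon_eq [NumberField F] (hd : d ≠ 0) (hF : F ≤ cyc (d * p ^ a)) (m : ℕ) :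
    epsilon p F a d m
      = ∏ z ∈ galOrbit (layer p F m) (zeta (d * p ^ max a m)), (1 - z) := by
  unfold epsilon
  split_ifs with h
  · rw [max_eq_right h, cycNorm_eq hd hF h]
  · have hma : m ≤ a := (not_le.1 h).le
    rw [max_eq_left hma]
    obtain ⟨ι, _, ρ, hρ, h'⟩ := exists_isCosetSystem_norm (layer_le_layer p F hma)
    refine Eq.trans (h' _ (cycNorm p F d a).2.1) ?_
    rw [cycNorm_eq hd hF le_rfl, ← hρ.prod_galOrbit (layer_le_layer p F hma)
      (layer_le_cyc hd hF le_rfl le_rfl) (fun z => 1 - z)]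
    refine Finset.prod_congr rfl fun i _ => ?_
    rw [map_prod]
    refine Finset.prod_congr rfl fun z _ => ?_
    rw [map_sub, map_one]

lemma epsilon_mem_layer [NumberField F] (m : ℕ) :
    epsilon p F a d m ∈ layer p F m := by
  unfold epsilon
  split_ifs with h
  · exact (cycNorm p F d m).2.1
  · exact Subtype.property _

lemma dvdPrimePow_epsilon [NumberField F] (hd : d ≠ 0) (hF : F ≤ cyc (d * p ^ a)) {m : ℕ}
    (hm : m ≠ 0) : DvdPrimePow p (epsilon p F a d m) := by
  have hp : p.Prime := Fact.out
  rw [epsilon_eq hd hF]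
  refine DvdPrimePow.prod fun z hz => ?_
  have h0 : d * p ^ max a m ≠ 0 := mul_ne_zero hd (pow_ne_zero _ hp.ne_zero)
  refine dvdPrimePow_one_sub hp h0 ?_ (isPrimitiveRoot_of_mem_galOrbit h0 hz)
  exact (dvd_pow_self p (by omega)).mul_left d

/-- If m + 1 ≤ a the two roots of unity coincide. Otherwise the norm relation applies with N = d
p^m, which p divides because m ≠ 0. -/
lemma prod_galOrbit_layer_succ (hd : d ≠ 0) (hF : F ≤ cyc (d * p ^ a)) {m : ℕ} (hm : m ≠ 0) :
    ∏ z ∈ galOrbit (layer p F m) (zeta (d * p ^ max a (m + 1))), (1 - z)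
      = ∏ z ∈ galOrbit (layer p F m) (zeta (d * p ^ max a m)), (1 - z) := by
  have hp : p.Prime := Fact.out
  rcases le_or_gt (m + 1) a with h | h
  · rw [max_eq_left h, max_eq_left (by omega)]
  · rw [max_eq_right h.le, max_eq_right (by omega), pow_succ', mul_left_comm]
    refine prod_one_sub_galOrbit_mul_prime hp (mul_ne_zero hd (pow_ne_zero _ hp.ne_zero))
      ((dvd_pow_self p hm).mul_left d) (layer_le_cyc hd hF (by omega) le_rfl)

end CyclotomicNumbers

lemma zeta_pow_eq_zeta_pow_iff {N : ℕ} (hN : N ≠ 0) {i j : ℕ} :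
    zeta N ^ i = zeta N ^ j ↔ (i : ZMod N) = j := by
  have h : IsOfFinOrder (zeta N) :=
    isOfFinOrder_iff_pow_eq_one.2 ⟨N, Nat.pos_of_ne_zero hN, zeta_pow_self N⟩
  rw [ZMod.natCast_eq_natCast_iff, h.pow_eq_pow_iff_modEq,
    ← (zeta_isPrimitiveRoot hN).eq_orderOf]

lemma exists_galOf_restrict {K L : Type*} [Field K] [Field L] [Algebra K L]
    {Ω : IntermediateField K L} {σ : Gal(L/K)} (h : ∀ x ∈ Ω, σ x ∈ Ω) (h' : ∀ x ∈ Ω, σ⁻¹ x ∈ Ω) :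
    ∃ γ : GalOf Ω, ∀ x : Ω, (γ x : L) = σ x :=
  ⟨{  toFun := fun x => ⟨σ x, h x x.2⟩
      invFun := fun x => ⟨σ⁻¹ x, h' x x.2⟩
      left_inv := fun x => Subtype.ext (AlgEquiv.symm_apply_apply σ (x : L))
      right_inv := fun x => Subtype.ext (AlgEquiv.apply_symm_apply σ (x : L))
      map_mul' := fun x y => Subtype.ext (map_mul σ (x : L) y)
      map_add' := fun x y => Subtype.ext (map_add σ (x : L) y)
      commutes' := fun x => Subtype.ext (σ.commutes x) }, fun _ => rfl⟩

/-! ### Automorphisms of Ω_S and their extensions to the algebraic numbers -/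

section GaloisGroup

variable {p : ℕ} {F : IntermediateField ℚ Qbar}

/-- An extension to `Qbar` of an automorphism of `Ω_S`. -/
def liftGal (γ : GS p F) : Gal(Qbar/ℚ) := AlgEquiv.liftNormal γ Qbar

lemma liftGal_apply (γ : GS p F) (x : Omega p F) : liftGal γ x = (γ x : Qbar) :=
  AlgEquiv.liftNormal_commutes γ Qbar x

lemma liftGal_apply_of_mem (γ : GS p F) {x : Qbar} (hx : x ∈ Omega p F) :
    liftGal γ x = (γ ⟨x, hx⟩ : Qbar) :=
  liftGal_apply γ ⟨x, hx⟩

lemma mem_galFix_iff {E : IntermediateField ℚ Qbar} (hE : E ≤ Omega p F) {γ : GS p F} :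
    γ ∈ galFix (Omega p F) E ↔ liftGal γ ∈ E.fixingSubgroup := by
  rw [mem_galFix, IntermediateField.mem_fixingSubgroup_iff]
  constructor
  · intro h x hx
    rw [liftGal_apply_of_mem γ (hE hx), h _ hx]
  · intro h x hx
    apply Subtype.ext
    rw [← liftGal_apply, h _ hx]

lemma galFix_antitone {E K : IntermediateField ℚ Qbar} (h : E ≤ K) :
    galFix (Omega p F) K ≤ galFix (Omega p F) E := by
  intro γ hγ
  rw [mem_galFix] at hγ ⊢
  exact fun x hx => hγ x (h hx)

lemma exists_restrict {σ : Gal(Qbar/ℚ)} (hσ : σ ∈ F.fixingSubgroup) :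
    ∃ γ : GS p F, ∀ x : Omega p F, (γ x : Qbar) = σ x := by
  have key : ∀ τ ∈ F.fixingSubgroup, ∀ x ∈ Omega p F, τ x ∈ Omega p F := by
    intro τ hτ x hx
    exact map_Omega_le (AlgEquiv.ofRingEquiv (f := τ.toRingEquiv) fun y =>
      (IntermediateField.mem_fixingSubgroup_iff _ _).1 hτ y y.2 : Gal(Qbar/F)) hx
  exact exists_galOf_restrict (key σ hσ) (key _ (inv_mem hσ))

lemma isCosetSystem_liftGal {E K : IntermediateField ℚ Qbar} (hF : F ≤ E) (hE : E ≤ K)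
    (hK : K ≤ Omega p F) : IsCosetSystem E K
      fun c : galFix (Omega p F) E ⧸ (galFix (Omega p F) K).subgroupOf (galFix (Omega p F) E) =>
        liftGal ((rep c : galFix (Omega p F) E) : GS p F) := by
  refine ⟨fun c => (mem_galFix_iff (hE.trans hK)).1 (rep c).2, fun σ hσ => ?_⟩
  have hiff : ∀ (γ δ : GS p F), γ⁻¹ * δ ∈ galFix (Omega p F) K ↔
      ∀ y ∈ K, liftGal δ y = liftGal γ y := by
    intro γ δ
    rw [mem_galFix]
    constructor
    · intro h y hy
      rw [liftGal_apply_of_mem γ (hK hy), liftGal_apply_of_mem δ (hK hy)]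
      have h1 := h ⟨y, hK hy⟩ hy
      have h2 := congrArg γ h1
      rw [AlgEquiv.mul_apply] at h2
      rw [← h2]
      exact congrArg _ (AlgEquiv.apply_symm_apply γ _).symm
    · intro h x hx
      have h1 := h x hx
      rw [liftGal_apply, liftGal_apply] at h1
      rw [AlgEquiv.mul_apply, Subtype.ext h1]
      exact AlgEquiv.symm_apply_apply γ x
  obtain ⟨γ, hγ⟩ := exists_restrict (p := p) (IntermediateField.fixingSubgroup_antitone hF hσ)
  have hγσ : ∀ y ∈ K, liftGal γ y = σ y := fun y hy => by
    rw [liftGal_apply_of_mem γ (hK hy), hγ]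
  have hγE : γ ∈ galFix (Omega p F) E := by
    rw [mem_galFix_iff (hE.trans hK), IntermediateField.mem_fixingSubgroup_iff]
    intro x hx
    rw [hγσ x (hE hx)]
    exact (IntermediateField.mem_fixingSubgroup_iff _ _).1 hσ x hx
  refine ⟨QuotientGroup.mk ⟨γ, hγE⟩, fun y hy => ?_, fun c hc => ?_⟩
  · rw [← hγσ y hy]
    exact (hiff _ _).1 (mk_eq_mk_iff.1 (rep_spec (QuotientGroup.mk ⟨γ, hγE⟩))) y hy
  · rw [← rep_spec c, mk_eq_mk_iff, hiff]
    intro y hy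
    rw [← hc y hy]
    exact hγσ y hy

lemma prod_liftGal_mem {ι : Type*} [Fintype ι] {γ : ι → GS p F} {v : Qbar}
    (hv : v ∈ Omega p F) (k : ι → ℕ) : ∏ i, liftGal (γ i) v ^ k i ∈ Omega p F := by
  refine prod_mem fun i _ => pow_mem ?_ _
  rw [liftGal_apply_of_mem _ hv]
  exact Subtype.property _

/-! ### Kummer cocycles -/

variable [Fact p.Prime]

/-- `f` is the Kummer cocycle of the `p^m`-th root `v`. -/
def IsKummerFun (m : ℕ) {V : Subgroup (GS p F)} (v : Qbar) (f : V → ZMod (p ^ m)) : Prop :=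
  ∀ σ : V, liftGal (σ : GS p F) v = zeta (p ^ m) ^ (f σ).val * v

lemma isKummerClass_iff {r m : ℕ} {U : Subgroup (GS p F)} {u : Qbar}
    {x : H1 (twist p F r m) U} :
    IsKummerClass p F r m U u x ↔ u ≠ 0 ∧ ∃ v ∈ Omega p F, v ^ p ^ m = u ∧
      ∃ f : Z1 (twist p F r m) U, IsKummerFun m v f.1 ∧ x = H1.mk _ U f := by
  unfold IsKummerClass IsKummerFun
  simp only [← liftGal_apply, Subtype.exists, exists_prop]

/-- If v is a p^{m+1}-th root of u, then v^p is a p^m-th root, and ζ_{p^{m+1}}^p = ζ_{p^m} reduces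
the exponent. -/
lemma IsKummerClass.reduction {r m : ℕ} {V : Subgroup (GS p F)} {u : Qbar}
    {x : H1 (twist p F r (m + 1)) V} (hx : IsKummerClass p F r (m + 1) V u x) :
    IsKummerClass p F r m V u (reduction p F r m V x) := by
  have hp : p.Prime := Fact.out
  have h0 : p ^ m ≠ 0 := pow_ne_zero m hp.ne_zero
  have : NeZero (p ^ m) := ⟨h0⟩
  have : NeZero (p ^ (m + 1)) := ⟨pow_ne_zero _ hp.ne_zero⟩
  obtain ⟨hu0, v, hv, rfl, f, hf, rfl⟩ := isKummerClass_iff.1 hx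
  refine isKummerClass_iff.2 ⟨hu0, v ^ p, pow_mem hv p, by rw [← pow_mul, pow_succ'], _, ?_, rfl⟩
  intro σ
  have h1 : zeta (p ^ (m + 1)) ^ p = zeta (p ^ m) := by
    rw [pow_succ']
    exact zeta_pow_of_mul hp.ne_zero
  rw [map_pow, hf σ, mul_pow, ← pow_mul, mul_comm _ p, pow_mul, h1]
  congr 1
  rw [zeta_pow_eq_zeta_pow_iff h0]
  change _ = ((ZMod.castHom (pow_dvd_pow p m.le_succ) (ZMod (p ^ m)) (f.1 σ)).val : ZMod (p ^ m))
  rw [ZMod.natCast_val, ZMod.natCast_val, ZMod.cast_id]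
  rfl

lemma isLocallyConstant_of_isKummerFun {m : ℕ} {V : Subgroup (GS p F)} {v : Qbar}
    (hv : v ∈ Omega p F) (hv0 : v ≠ 0) {f : V → ZMod (p ^ m)} (hf : IsKummerFun m v f) :
    IsLocallyConstant f := by
  have hp : p.Prime := Fact.out
  have h0 : p ^ m ≠ 0 := pow_ne_zero m hp.ne_zero
  have : NeZero (p ^ m) := ⟨h0⟩
  let E : IntermediateField ℚ Qbar := IntermediateField.adjoin ℚ {v}
  have : FiniteDimensional ℚ E :=
    IntermediateField.adjoin.finiteDimensional (Algebra.IsIntegral.isIntegral v)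
  rw [IsLocallyConstant.iff_exists_open]
  intro σ
  refine ⟨(fun τ : V => (σ : GS p F)⁻¹ * τ) ⁻¹' (galFix (Omega p F) E : Set (GS p F)),
    (isOpen_galFix _ E).preimage (by fun_prop), ?_, fun τ hτ => ?_⟩
  · simp [one_mem]
  · have h1 := mem_galFix.1 hτ ⟨v, hv⟩
      (IntermediateField.mem_adjoin_simple_self ℚ _)
    have h2 : (τ : GS p F) ⟨v, hv⟩ = (σ : GS p F) ⟨v, hv⟩ := by
      have := congrArg (σ : GS p F) h1
      rw [AlgEquiv.mul_apply] at this
      rw [← this]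
      exact (AlgEquiv.apply_symm_apply (σ : GS p F) _).symm
    have h3 := congrArg Subtype.val h2
    rw [← liftGal_apply_of_mem, ← liftGal_apply_of_mem, hf, hf] at h3
    have h4 := (zeta_pow_eq_zeta_pow_iff h0).1 (mul_right_cancel₀ hv0 h3)
    simpa using h4

variable [NumberField F]

lemma zeta_mem_Omega (m : ℕ) : zeta (p ^ m) ∈ Omega p F :=
  layer_le_Omega (Fact.out : p.Prime).ne_zero m
    ((le_sup_right : cyc (p ^ m) ≤ layer p F m) (zeta_mem_cyc _))

lemma liftGal_zeta (γ : GS p F) (m : ℕ) : liftGal γ (zeta (p ^ m))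
    = zeta (p ^ m) ^ (PadicInt.toZModPow m (kappa p F γ : ℤ_[p])).val := by
  have hp : p.Prime := Fact.out
  -- The defining property of `cyclotomicCharacter` is available because Ω_S contains all roots of
  -- unity of p-power order.
  have : ∀ i, HasEnoughRootsOfUnity (Omega p F) (p ^ i) := by
    intro i
    have : NeZero (p ^ i) := ⟨pow_ne_zero i hp.ne_zero⟩
    refine ⟨⟨⟨zeta (p ^ i), zeta_mem_Omega i⟩, ?_⟩, rootsOfUnity.isCyclic _ _⟩
    exact IsPrimitiveRoot.of_map_of_injective (f := (Omega p F).val)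
      (zeta_isPrimitiveRoot (pow_ne_zero i hp.ne_zero)) (Omega p F).val.injective
  have h := cyclotomicCharacter.spec p (n := m)
    (MulSemiringAction.toRingAut (GS p F) (Omega p F) γ) ⟨zeta (p ^ m), zeta_mem_Omega m⟩
    (Subtype.ext (zeta_pow_self _))
  rw [liftGal_apply_of_mem γ (zeta_mem_Omega m)]
  exact congrArg Subtype.val h

lemma toZModPow_kappa_eq_one {m : ℕ} {γ : GS p F} (hγ : γ ∈ galSLayer p F m) :
    PadicInt.toZModPow m (kappa p F γ : ℤ_[p]) = 1 := by
  have hp : p.Prime := Fact.out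
  have h0 : p ^ m ≠ 0 := pow_ne_zero m hp.ne_zero
  have : NeZero (p ^ m) := ⟨h0⟩
  have h := (mem_galFix_iff (layer_le_Omega hp.ne_zero m)).1 hγ
  have h1 := (IntermediateField.mem_fixingSubgroup_iff _ _).1 h (zeta (p ^ m))
    ((le_sup_right : cyc (p ^ m) ≤ layer p F m) (zeta_mem_cyc _))
  rw [liftGal_zeta] at h1
  conv_rhs at h1 => rw [← pow_one (zeta (p ^ m))]
  rw [zeta_pow_eq_zeta_pow_iff h0] at h1
  simpa using h1

lemma liftGal_zeta_of_mem {m : ℕ} {γ : GS p F} (hγ : γ ∈ galSLayer p F m) :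
    liftGal γ (zeta (p ^ m)) = zeta (p ^ m) :=
  (IntermediateField.mem_fixingSubgroup_iff _ _).1
    ((mem_galFix_iff (layer_le_Omega (Fact.out : p.Prime).ne_zero m)).1 hγ) _
    ((le_sup_right : cyc (p ^ m) ≤ layer p F m) (zeta_mem_cyc _))

/-- G_S(F_m) fixes both u and ζ_{p^m}, so σ(v)/v is a p^m-th root of unity and a homomorphism in σ;
the twist is trivial on this group, so this is the cocycle condition. -/
lemma exists_isKummerClass {r m : ℕ} {u : Qbar} (hu : u ∈ layer p F m) (hd : DvdPrimePow p u) :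
    ∃ x, IsKummerClass p F r m (galSLayer p F m) u x := by
  have hp : p.Prime := Fact.out
  have h0 : p ^ m ≠ 0 := pow_ne_zero m hp.ne_zero
  have : NeZero (p ^ m) := ⟨h0⟩
  have hu0 := hd.ne_zero hp.ne_zero
  obtain ⟨v, rfl⟩ := IsAlgClosed.exists_pow_nat_eq u (Nat.pos_of_ne_zero h0)
  have hv : v ∈ Omega p F := root_mem_Omega hp.ne_zero hu hd
  have hv0 : v ≠ 0 := fun h => hu0 (by rw [h, zero_pow h0])
  have key : ∀ σ : galSLayer p F m, ∃ i : ZMod (p ^ m),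
      liftGal (σ : GS p F) v = zeta (p ^ m) ^ i.val * v := by
    intro σ
    have h1 : (liftGal (σ : GS p F) v / v) ^ p ^ m = 1 := by
      rw [div_pow, ← map_pow, (IntermediateField.mem_fixingSubgroup_iff _ _).1
        ((mem_galFix_iff (layer_le_Omega hp.ne_zero m)).1 σ.2) _ hu, div_self hu0]
    obtain ⟨i, hi, h⟩ := (zeta_isPrimitiveRoot h0).eq_pow_of_pow_eq_one h1
    refine ⟨i, ?_⟩
    rw [ZMod.val_natCast_of_lt hi, h, div_mul_cancel₀ _ hv0]
  choose f hf using key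
  have hf' : IsKummerFun m v f := hf
  refine ⟨H1.mk _ _ ⟨f, isLocallyConstant_of_isKummerFun hv hv0 hf', fun σ τ => ?_⟩,
    isKummerClass_iff.2 ⟨hu0, v, hv, rfl, _, hf', rfl⟩⟩
  rw [twist_apply, toZModPow_kappa_eq_one σ.2, one_pow, one_mul]
  have h1 := hf (σ * τ)
  -- The extensions `liftGal` are chosen; multiplicativity is used only on elements of Ω_S.
  have h2 : liftGal ((σ * τ : galSLayer p F m) : GS p F) v
      = liftGal (σ : GS p F) (liftGal (τ : GS p F) v) := by
    rw [liftGal_apply_of_mem _ hv, liftGal_apply_of_mem (τ : GS p F) hv, liftGal_apply]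
    rfl
  rw [h2, hf τ, map_mul, map_pow, liftGal_zeta_of_mem σ.2, hf σ, ← mul_assoc, ← pow_add] at h1
  have h3 := (zeta_pow_eq_zeta_pow_iff h0).1 (mul_right_cancel₀ hv0 h1)
  simp only [Nat.cast_add, ZMod.natCast_val, ZMod.cast_id', id_eq] at h3
  rw [← h3, add_comm]

/-- Two p^m-th roots of u differ by a root of unity fixed by V, so even the cocycles agree. -/
lemma IsKummerClass.unique {r m : ℕ} {V : Subgroup (GS p F)} (hV : V ≤ galSLayer p F m)
    {u : Qbar} {x y : H1 (twist p F r m) V} (hx : IsKummerClass p F r m V u x)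
    (hy : IsKummerClass p F r m V u y) : x = y := by
  have hp : p.Prime := Fact.out
  have h0 : p ^ m ≠ 0 := pow_ne_zero m hp.ne_zero
  have : NeZero (p ^ m) := ⟨h0⟩
  obtain ⟨hu0, v, hv, hvu, f, hf, rfl⟩ := isKummerClass_iff.1 hx
  obtain ⟨-, w, hw, hwu, g, hg, rfl⟩ := isKummerClass_iff.1 hy
  have hv0 : v ≠ 0 := fun h => hu0 (by rw [← hvu, h, zero_pow h0])
  have hw0 : w ≠ 0 := fun h => hu0 (by rw [← hwu, h, zero_pow h0])
  congr 1
  refine Subtype.ext (funext fun σ => ?_)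
  have h1 : (w / v) ^ p ^ m = 1 := by rw [div_pow, hvu, hwu, div_self hu0]
  obtain ⟨i, -, h⟩ := (zeta_isPrimitiveRoot h0).eq_pow_of_pow_eq_one h1
  have hwv : w = zeta (p ^ m) ^ i * v := by rw [h, div_mul_cancel₀ _ hv0]
  have h2 := hg σ
  rw [hwv, map_mul, map_pow, liftGal_zeta_of_mem (hV σ.2), hf σ, mul_left_comm] at h2
  have h3 := (zeta_pow_eq_zeta_pow_iff h0).1
    (mul_right_cancel₀ (mul_ne_zero (pow_ne_zero i ((zeta_isPrimitiveRoot h0).ne_zero h0)) hv0) h2)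
  simpa using h3

lemma isKummerClass_kummerClass {r m : ℕ} {u : Qbar} (hu : u ∈ layer p F m)
    (hd : DvdPrimePow p u) : IsKummerClass p F r m (galSLayer p F m) u
      (kummerClass p F r m (galSLayer p F m) u) := by
  have h := exists_isKummerClass (r := r) hu hd
  rw [kummerClass, dif_pos h]
  exact h.choose_spec

/-! ### Corestriction of Kummer classes and coherence of the special element -/

/-- The corestriction of a Kummer cocycle is the Kummer cocycle of a twisted norm, on those
elements whose action on cosets preserves the twist. -/
lemma liftGal_prod_rep {r m : ℕ} (hr : r ≠ 0) {U V : Subgroup (GS p F)}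
    [Fintype (U ⧸ V.subgroupOf U)] {v : Qbar} (hv : v ∈ Omega p F) {f : V → ZMod (p ^ m)}
    (hf : IsKummerFun m v f) (k : U ⧸ V.subgroupOf U → ℕ)
    (hk : ∀ c, (k c : ZMod (p ^ m))
      = PadicInt.toZModPow m (kappa p F (rep c : U) : ℤ_[p]) ^ (r - 1))
    (σ : U) (hσ : ∀ c, k (σ • c) = k c) :
    liftGal (σ : GS p F) (∏ c, liftGal ((rep c : U) : GS p F) v ^ k c)
      = zeta (p ^ m) ^ (corFun (twist p F r m) f σ).val
        * ∏ c, liftGal ((rep c : U) : GS p F) v ^ k c := by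
  have hp : p.Prime := Fact.out
  have h0 : p ^ m ≠ 0 := pow_ne_zero m hp.ne_zero
  have : NeZero (p ^ m) := ⟨h0⟩
  let w : U ⧸ V.subgroupOf U → V := fun c => ⟨((rep (σ • c))⁻¹ * σ * rep c : U), rep_mem σ c⟩
  let χ : U ⧸ V.subgroupOf U → ZMod (p ^ m) := fun c =>
    PadicInt.toZModPow m (kappa p F (rep c : U) : ℤ_[p])
  -- From σ s(c) = s(σc) w(c): w(c) multiplies v by ζ^{f(w(c))}, and s(σc) raises ζ to its
  -- cyclotomic character.
  have h1 : ∀ c, liftGal (σ : GS p F) (liftGal ((rep c : U) : GS p F) v)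
      = zeta (p ^ m) ^ ((χ (σ • c)).val * (f (w c)).val)
        * liftGal ((rep (σ • c) : U) : GS p F) v := by
    intro c
    have h2 : liftGal (σ : GS p F) (liftGal ((rep c : U) : GS p F) v)
        = liftGal ((rep (σ • c) : U) : GS p F) (liftGal (w c : GS p F) v) := by
      rw [liftGal_apply_of_mem _ hv, liftGal_apply, liftGal_apply_of_mem _ hv, liftGal_apply]
      have : (σ : GS p F) * (rep c : U) = (rep (σ • c) : U) * (w c : GS p F) := by
        simp only [w, Subgroup.coe_mul, Subgroup.coe_inv]
        group
      exact congrArg Subtype.val (DFunLike.congr_fun this ⟨v, hv⟩)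
    rw [h2, hf, map_mul, map_pow, liftGal_zeta, ← pow_mul]
  have h2 : ∏ c, (zeta (p ^ m) ^ ((χ (σ • c)).val * (f (w c)).val)) ^ k c
      = zeta (p ^ m) ^ (corFun (twist p F r m) f σ).val := by
    simp only [← pow_mul]
    rw [Finset.prod_pow_eq_pow_sum, zeta_pow_eq_zeta_pow_iff h0]
    simp only [Nat.cast_sum, Nat.cast_mul, ZMod.natCast_val, ZMod.cast_id', id_eq, corFun,
      twist_apply]
    refine Finset.sum_congr rfl fun c _ => ?_
    rw [← hσ c, hk, mul_right_comm]
    congr 1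
    -- One factor of the character comes from the action on ζ, the other r - 1 from the exponent k;
    -- together they give the twist by r.
    rw [mul_comm, pow_sub_one_mul hr]
  rw [map_prod, ← h2]
  have h3 : ∏ c, liftGal ((rep c : U) : GS p F) v ^ k c
      = ∏ c, liftGal ((rep (σ • c) : U) : GS p F) v ^ k c := by
    refine (Fintype.prod_equiv (MulAction.toPerm σ) _ _ fun c => ?_).symm
    rw [← hσ c]
    rfl
  conv_rhs => rw [h3, ← Finset.prod_mul_distrib]
  refine Finset.prod_congr rfl fun c _ => ?_
  rw [map_pow, h1, mul_pow]

/-- Over a field whose group fixes F_m the character is 1 modulo p^m, so the twisted norm with all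
exponents 1 serves for every σ. -/
lemma IsKummerClass.cor {r m : ℕ} (hr : r ≠ 0) {E K : IntermediateField ℚ Qbar}
    [FiniteDimensional ℚ K] (hE : galFix (Omega p F) E ≤ galSLayer p F m) {u : Qbar}
    {x : H1 (twist p F r m) (galFix (Omega p F) K)}
    (hx : IsKummerClass p F r m (galFix (Omega p F) K) u x) :
    letI := Fintype.ofFinite
      (galFix (Omega p F) E ⧸ (galFix (Omega p F) K).subgroupOf (galFix (Omega p F) E))
    IsKummerClass p F r m (galFix (Omega p F) E)
      (∏ c : galFix (Omega p F) E ⧸ (galFix (Omega p F) K).subgroupOf (galFix (Omega p F) E),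
        liftGal ((rep c : galFix (Omega p F) E) : GS p F) u)
      (H1.cor (twist p F r m) (galFix (Omega p F) E) (galFix (Omega p F) K)
        (isOpen_galFix _ _) x) := by
  let _ := Fintype.ofFinite
      (galFix (Omega p F) E ⧸ (galFix (Omega p F) K).subgroupOf (galFix (Omega p F) E))
  obtain ⟨hu0, v, hv, rfl, f, hf, rfl⟩ := isKummerClass_iff.1 hx
  refine isKummerClass_iff.2 ⟨?_,
    ∏ c : galFix (Omega p F) E ⧸ (galFix (Omega p F) K).subgroupOf (galFix (Omega p F) E),
      liftGal ((rep c : galFix (Omega p F) E) : GS p F) v ^ 1,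
    prod_liftGal_mem hv _, ?_, _, ?_,
    H1.cor_mk (galFix (Omega p F) E) (galFix (Omega p F) K) (isOpen_galFix _ _) f⟩
  · exact Finset.prod_ne_zero_iff.2 fun c _ => (map_ne_zero _).2 hu0
  · rw [← Finset.prod_pow]
    refine Finset.prod_congr rfl fun c _ => ?_
    rw [pow_one, map_pow]
  · intro σ
    refine liftGal_prod_rep hr hv hf (fun _ => 1) (fun c => ?_) σ fun _ => rfl
    rw [toZModPow_kappa_eq_one (hE (rep c).2), one_pow, Nat.cast_one]

lemma special_mem_H1Zp {d a r : ℕ} (hd : d ≠ 0) (hF : F ≤ cyc (d * p ^ a)) (hr : r ≠ 0) :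
    special p F a d r ∈ H1Zp p F r := by
  have hp : p.Prime := Fact.out
  intro m
  -- At level 0 the coefficients vanish. This case is separate because 1 - z need not divide a power
  -- of p when p does not divide the order of z.
  rcases eq_or_ne m 0 with rfl | hm
  · have : Subsingleton (ZMod (p ^ 0)) := by rw [pow_zero]; infer_instance
    have : Subsingleton (H1 (twist p F r 0) (galS p F)) := by
      refine ⟨fun x y => ?_⟩
      obtain ⟨f, rfl⟩ := H1.mk_surjective x
      obtain ⟨g, rfl⟩ := H1.mk_surjective y
      congr 1
      exact Subtype.ext (funext fun _ => Subsingleton.elim _ _)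
    exact Subsingleton.elim _ _
  · have h1 := isKummerClass_kummerClass (r := r) (epsilon_mem_layer (a := a) (d := d) (m + 1))
      (dvdPrimePow_epsilon (F := F) hd hF m.succ_ne_zero)
    have hle : layer p F m ≤ layer p F (m + 1) := layer_le_layer p F m.le_succ
    have h2 := h1.reduction.cor hr (E := layer p F m) le_rfl
    have h3 := isKummerClass_kummerClass (r := r) (epsilon_mem_layer (a := a) (d := d) m)
      (dvdPrimePow_epsilon (F := F) hd hF hm)
    let _ := Fintype.ofFinite (galSLayer p F m ⧸
      (galSLayer p F (m + 1)).subgroupOf (galSLayer p F m))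
    have h4 : ∏ c : galSLayer p F m ⧸ (galSLayer p F (m + 1)).subgroupOf (galSLayer p F m),
        liftGal ((rep c : galSLayer p F m) : GS p F) (epsilon p F a d (m + 1))
          = epsilon p F a d m := by
      rw [epsilon_eq hd hF, epsilon_eq hd hF, ← prod_galOrbit_layer_succ hd hF hm,
        ← (isCosetSystem_liftGal (p := p) (F := F) (E := layer p F m) le_sup_left hle
          (layer_le_Omega hp.ne_zero _)).prod_galOrbit hle
          (layer_le_cyc hd hF (le_max_left a (m + 1)) (le_max_right a (m + 1)))
          (fun z => 1 - z)]
      refine Finset.prod_congr rfl fun c _ => ?_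
      rw [map_prod]
      refine Finset.prod_congr rfl fun z _ => ?_
      rw [map_sub, map_one]
    rw [h4] at h2
    have h5 := h2.unique le_rfl h3
    change reduction p F r m _ (H1.cor _ _ _ _ _) = H1.cor _ _ _ _ _
    rw [← h5]
    refine Eq.trans ?_ (H1.cor_cor (galFix_antitone (le_sup_left : F ≤ layer p F m))
      (galFix_antitone hle) (isOpen_galFix _ _) (isOpen_galFix _ _) _).symm
    exact H1.coeffMap_cor _ _ _ _ _ _

end GaloisGroup

/-! ### Residue fields and decomposition groups at ℓ -/

section Residue

open Classical in
/-- An algebraic number as an algebraic integer (junk value `0` if it is not integral). -/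
def toInt (x : Qbar) : 𝓞 Qbar :=
  if h : IsIntegral ℤ x then ⟨x, (mem_integralClosure_iff ℤ Qbar).2 h⟩ else 0

lemma coe_toInt {x : Qbar} (h : IsIntegral ℤ x) : (toInt x : Qbar) = x := by
  have h1 : toInt x = ⟨x, (mem_integralClosure_iff ℤ Qbar).2 h⟩ := dif_pos h
  rw [h1]
  rfl

/-- A primitive `N`-th root of unity `y` modulo `ℓ` which is the reduction of `ζ_N` modulo `P`. -/
structure IsResidueOfZeta (N ℓ : ℕ) (P : Ideal (𝓞 Qbar)) (y : ZMod ℓ) : Prop where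
  prime : P.IsPrime
  mem : (ℓ : 𝓞 Qbar) ∈ P
  primitive : IsPrimitiveRoot y N
  sub_mem : zetaInt N - (y.val : 𝓞 Qbar) ∈ P

variable {N ℓ : ℕ} [Fact ℓ.Prime] {P : Ideal (𝓞 Qbar)} {y : ZMod ℓ}

/-- The embedding of the prime field in the residue ring. -/
lemma exists_residue (hP : P.IsPrime) (hℓ : (ℓ : 𝓞 Qbar) ∈ P) :
    ∃ ι : ZMod ℓ →+* 𝓞 Qbar ⧸ P, Function.Injective ι ∧
      (∀ x : ZMod ℓ, ι x = Ideal.Quotient.mk P (x.val : 𝓞 Qbar)) ∧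
      ∀ x : ℤ, ι (x : ZMod ℓ) = Ideal.Quotient.mk P (x : 𝓞 Qbar) := by
  have h0 : ((ℓ : ℕ) : 𝓞 Qbar ⧸ P) = 0 := by
    rw [← map_natCast (Ideal.Quotient.mk P), Ideal.Quotient.eq_zero_iff_mem]
    exact hℓ
  have : CharP (𝓞 Qbar ⧸ P) ℓ := (CharP.charP_iff_prime_eq_zero Fact.out).2 h0
  refine ⟨ZMod.castHom dvd_rfl _, RingHom.injective _, fun x => ?_, fun x => ?_⟩
  · conv_lhs => rw [← ZMod.natCast_zmod_val x]
    rw [map_natCast, map_natCast]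
  · rw [map_intCast, map_intCast]

lemma IsResidueOfZeta.exists_residue (h : IsResidueOfZeta N ℓ P y) :
    ∃ ι : ZMod ℓ →+* 𝓞 Qbar ⧸ P, Function.Injective ι ∧
      (∀ x : ZMod ℓ, ι x = Ideal.Quotient.mk P (x.val : 𝓞 Qbar)) ∧
      ∀ j : ℕ, Ideal.Quotient.mk P (zetaInt N ^ j) = ι (y ^ j) := by
  obtain ⟨ι, h1, h2, -⟩ := TwistedCyclotomic.exists_residue h.prime h.mem
  refine ⟨ι, h1, h2, fun j => ?_⟩
  rw [map_pow, map_pow, h2]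
  congr 1
  exact Ideal.Quotient.eq.2 h.sub_mem

lemma coe_smul_ringOfIntegers {p : ℕ} {F : IntermediateField ℚ Qbar} (σ : GS p F)
    (v : 𝓞 (Omega p F)) :
    ((algebraMap (𝓞 (Omega p F)) (𝓞 Qbar) (σ • v) : 𝓞 Qbar) : Qbar)
      = liftGal σ (algebraMap (𝓞 (Omega p F)) (𝓞 Qbar) v : 𝓞 Qbar) :=
  (liftGal_apply σ (v : Omega p F)).symm

variable {p : ℕ} {F : IntermediateField ℚ Qbar}

lemma prod_galOrbit_mem {E : IntermediateField ℚ Qbar} (x : Qbar) {g : Qbar → Qbar}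
    (hg : ∀ (σ : Gal(Qbar/ℚ)) (z : Qbar), σ (g z) = g (σ z)) : ∏ z ∈ galOrbit E x, g z ∈ E := by
  suffices h : ∏ z ∈ galOrbit E x, g z ∈ IntermediateField.fixedField E.fixingSubgroup by
    rwa [InfiniteGalois.fixedField_fixingSubgroup] at h
  rw [IntermediateField.mem_fixedField_iff]
  intro σ hσ
  rw [map_prod]
  simp only [hg]
  exact smul_galOrbit hσ g

/-- The number e = ∏ (y - z), over the E-conjugates z of ζ_N, lies in E and in P. If σ is in the
decomposition group then σ(e) ∈ P, so some σ(z) reduces to y. Roots of unity of order dividing N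
stay distinct modulo P because y is primitive, so σ(z) = ζ_N, and σ is trivial on E. -/
lemma decomp_le_galFix (h : IsResidueOfZeta N ℓ P y) (hN : N ≠ 0)
    {E : IntermediateField ℚ Qbar} (hE : E ≤ cyc N) (hEΩ : E ≤ Omega p F) :
    decomp p F P ≤ galFix (Omega p F) E := by
  intro σ hσ
  have := h.prime
  have hzi : ∀ z ∈ galOrbit E (zeta N), ∀ τ : Gal(Qbar/ℚ), IsIntegral ℤ (τ z) := by
    intro z hz τ
    exact ((isPrimitiveRoot_of_mem_galOrbit hN hz).map_of_injective τ.injective).isIntegral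
      (Nat.pos_of_ne_zero hN)
  have hzi1 : ∀ z ∈ galOrbit E (zeta N), IsIntegral ℤ z := fun z hz => hzi z hz 1
  set e : Qbar := ∏ z ∈ galOrbit E (zeta N), ((y.val : Qbar) - z) with he
  have heE : e ∈ E := prod_galOrbit_mem _ fun σ z => by rw [map_sub, map_natCast]
  have hei : IsIntegral ℤ e := IsIntegral.prod _ fun z hz =>
    (isIntegral_natCast _).sub (hzi1 z hz)
  have hei' : IsIntegral ℤ (⟨e, hEΩ heE⟩ : Omega p F) :=
    (isIntegral_algHom_iff (algebraMap (Omega p F) Qbar).toIntAlgHom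
      (algebraMap (Omega p F) Qbar).injective).1 hei
  let e' : 𝓞 (Omega p F) := ⟨⟨e, hEΩ heE⟩, hei'⟩
  have heP : algebraMap (𝓞 (Omega p F)) (𝓞 Qbar) e' ∈ P := by
    have h1 : algebraMap (𝓞 (Omega p F)) (𝓞 Qbar) e'
        = ∏ z ∈ galOrbit E (zeta N), ((y.val : 𝓞 Qbar) - toInt z) := by
      apply NumberField.RingOfIntegers.ext
      rw [NumberField.RingOfIntegers.coe_eq_algebraMap (∏ _ ∈ _, _), map_prod]
      change e = _
      refine Finset.prod_congr rfl fun z hz => ?_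
      rw [map_sub, map_natCast]
      congr 1
      exact (coe_toInt (hzi1 z hz)).symm
    rw [h1]
    have h2 : zeta N ∈ galOrbit E (zeta N) := mem_galOrbit.2 ⟨1, one_mem _, rfl⟩
    refine Ideal.mem_of_dvd _ (Finset.dvd_prod_of_mem _ h2) ?_
    have h3 : toInt (zeta N) = zetaInt N :=
      NumberField.RingOfIntegers.ext (coe_toInt (hzi1 _ h2))
    rw [h3, ← neg_sub]
    exact P.neg_mem h.sub_mem
  have hσP : algebraMap (𝓞 (Omega p F)) (𝓞 Qbar) (σ • e') ∈ P := by
    have h1 : σ • P.comap (algebraMap (𝓞 (Omega p F)) (𝓞 Qbar))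
        = P.comap (algebraMap (𝓞 (Omega p F)) (𝓞 Qbar)) := hσ.1
    have h2 : σ • e' ∈ σ • P.comap (algebraMap (𝓞 (Omega p F)) (𝓞 Qbar)) :=
      Ideal.smul_mem_pointwise_smul _ _ _ heP
    rw [h1] at h2
    exact h2
  have h1 : algebraMap (𝓞 (Omega p F)) (𝓞 Qbar) (σ • e')
      = ∏ z ∈ galOrbit E (zeta N), ((y.val : 𝓞 Qbar) - toInt (liftGal σ z)) := by
    apply NumberField.RingOfIntegers.ext
    rw [coe_smul_ringOfIntegers, NumberField.RingOfIntegers.coe_eq_algebraMap (∏ _ ∈ _, _),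
      map_prod]
    change liftGal σ e = _
    rw [he, map_prod]
    refine Finset.prod_congr rfl fun z hz => ?_
    rw [map_sub, map_natCast, map_sub, map_natCast]
    congr 1
    exact (coe_toInt (hzi z hz _)).symm
  rw [h1, Ideal.IsPrime.prod_mem_iff] at hσP
  obtain ⟨z, hz, hzP⟩ := hσP
  obtain ⟨τ, hτ, rfl⟩ := mem_galOrbit.1 hz
  obtain ⟨j, -, hj⟩ := exists_apply_zeta_eq_pow hN (liftGal σ * τ)
  obtain ⟨ι, hι, hι1, hι2⟩ := h.exists_residue
  have h2 : toInt (liftGal σ (τ (zeta N))) = zetaInt N ^ j := by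
    apply NumberField.RingOfIntegers.ext
    rw [coe_toInt (hzi _ hz _)]
    exact hj
  rw [h2] at hzP
  have h3 : y = y ^ j := by
    apply hι
    rw [← hι2, hι1]
    exact Ideal.Quotient.eq.2 hzP
  have h4 : zeta N ^ j = zeta N := by
    have h5 : IsOfFinOrder y :=
      isOfFinOrder_iff_pow_eq_one.2 ⟨N, Nat.pos_of_ne_zero hN, h.primitive.pow_eq_one⟩
    have h6 : y ^ 1 = y ^ j := by rwa [pow_one]
    rw [h5.pow_eq_pow_iff_modEq, ← h.primitive.eq_orderOf,
      ← ZMod.natCast_eq_natCast_iff, ← zeta_pow_eq_zeta_pow_iff hN, pow_one] at h6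
    exact h6.symm
  rw [mem_galFix_iff hEΩ, IntermediateField.mem_fixingSubgroup_iff]
  intro x hx
  have h5 : (liftGal σ * τ) x = (1 : Gal(Qbar/ℚ)) x :=
    apply_eq_of_mem_cyc (by rw [hj, h4]; rfl) (hE hx)
  rw [AlgEquiv.mul_apply, (IntermediateField.mem_fixingSubgroup_iff _ _).1 hτ x hx] at h5
  exact h5

/-- Automorphisms commute on ℚ(ζ_N), so the fixing group of a subfield is stable under conjugation.
-/
lemma conj_mem_galFix {E : IntermediateField ℚ Qbar} (hN : N ≠ 0) (hE : E ≤ cyc N)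
    {σ : GS p F} (hσ : σ ∈ galFix (Omega p F) E) (γ : GS p F) :
    γ⁻¹ * σ * γ ∈ galFix (Omega p F) E := by
  have hcomm : (liftGal σ * liftGal γ) (zeta N) = (liftGal γ * liftGal σ) (zeta N) := by
    obtain ⟨i, -, hi⟩ := exists_apply_zeta_eq_pow hN (liftGal σ)
    obtain ⟨j, -, hj⟩ := exists_apply_zeta_eq_pow hN (liftGal γ)
    rw [AlgEquiv.mul_apply, AlgEquiv.mul_apply, hi, hj, map_pow, map_pow, hi, hj, ← pow_mul,
      ← pow_mul, mul_comm]
  rw [mem_galFix]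
  intro x hx
  have h1 := apply_eq_of_mem_cyc hcomm (hE hx)
  rw [AlgEquiv.mul_apply, AlgEquiv.mul_apply, liftGal_apply σ x, mem_galFix.1 hσ x hx,
    liftGal_apply γ x, liftGal_apply σ (γ x)] at h1
  have h2 : σ (γ x) = γ x := Subtype.ext h1
  rw [AlgEquiv.mul_apply, AlgEquiv.mul_apply, h2]
  exact AlgEquiv.symm_apply_apply γ x

end Residue

/-! ### Roots of unity modulo the conjugate primes, and systems of representatives -/

section Congruences

lemma zpow_eq_pow_emod {G : Type*} [DivisionRing G] {x : G} {N : ℕ} (hN : N ≠ 0) (hx : x ^ N = 1)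
    (i : ℤ) : x ^ i = x ^ (i % N).toNat := by
  have hx0 : x ≠ 0 := by
    rintro rfl
    rw [zero_pow hN] at hx
    exact zero_ne_one hx
  have h1 : i = ((i % N).toNat : ℤ) + N * (i / N) := by
    rw [Int.toNat_of_nonneg (Int.emod_nonneg i (by exact_mod_cast hN)), Int.emod_add_mul_ediv]
  conv_lhs => rw [h1]
  rw [zpow_add₀ hx0, zpow_mul, zpow_natCast, zpow_natCast, hx, one_zpow, mul_one]

lemma emod_toNat_cast {N : ℕ} (hN : N ≠ 0) (i : ℤ) :
    (((i % N).toNat : ℕ) : ZMod N) = (i : ZMod N) := by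
  have h1 : (((i % N).toNat : ℕ) : ℤ) = i % N :=
    Int.toNat_of_nonneg (Int.emod_nonneg i (by exact_mod_cast hN))
  rw [← Int.cast_natCast, h1, ZMod.intCast_mod]

variable {N ℓ : ℕ} [Fact ℓ.Prime]

/-- Applying τ to the congruence for ζ_N modulo 𝔏 gives one for ζ_N^j modulo τ(𝔏), where τ(ζ_N) =
ζ_N^j. Raising it to the power A, inverse to j modulo N, recovers ζ_N. -/
lemma isResidueOfZeta_smul (hN : N ≠ 0) (hℓ : ℓ ≡ 1 [MOD N]) {𝔏 : Ideal (𝓞 Qbar)}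
    (hprime : 𝔏.IsPrime) (h𝔏 : (ℓ : 𝓞 Qbar) ∈ 𝔏) {ξ : ℤ} (hξ : orderOf (ξ : ZMod ℓ) = ℓ - 1)
    (hξ𝔏 : zetaInt N - (ξ : 𝓞 Qbar) ^ ((ℓ - 1) / N) ∈ 𝔏) {A : ℤ} {τ : Gal(Qbar/ℚ)}
    (hA : τ (zeta N ^ A) = zeta N) :
    IsResidueOfZeta N ℓ (τ • 𝔏) ((ξ : ZMod ℓ) ^ (A * (((ℓ - 1) / N : ℕ) : ℤ))) := by
  have hℓp : ℓ.Prime := Fact.out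
  have hdvd : N ∣ ℓ - 1 := (Nat.modEq_iff_dvd' hℓp.one_le).1 hℓ.symm
  have hprim0 : IsPrimitiveRoot (ξ : ZMod ℓ) (ℓ - 1) := hξ ▸ IsPrimitiveRoot.orderOf _
  have hprim : IsPrimitiveRoot ((ξ : ZMod ℓ) ^ ((ℓ - 1) / N)) N :=
    hprim0.pow (Nat.sub_pos_of_lt hℓp.one_lt) (Nat.div_mul_cancel hdvd).symm
  obtain ⟨j, -, hj⟩ := exists_apply_zeta_eq_pow hN τ
  set A₀ : ℕ := (A % N).toNat
  have hA₀ : zeta N ^ A = zeta N ^ A₀ := zpow_eq_pow_emod hN (zeta_pow_self N) A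
  have hjA : zeta N ^ (j * A₀) = zeta N := by
    rw [hA₀, map_pow, hj, ← pow_mul] at hA
    exact hA
  have hcop : A₀.Coprime N := by
    have h1 : zeta N ^ (j * A₀) = zeta N ^ 1 := by rw [hjA, pow_one]
    rw [zeta_pow_eq_zeta_pow_iff hN, Nat.cast_mul, Nat.cast_one, mul_comm] at h1
    exact (ZMod.isUnit_iff_coprime _ _).1 (IsUnit.of_mul_eq_one _ h1)
  have hy : (ξ : ZMod ℓ) ^ (A * (((ℓ - 1) / N : ℕ) : ℤ)) = ((ξ : ZMod ℓ) ^ ((ℓ - 1) / N)) ^ A₀ := by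
    rw [mul_comm, zpow_mul, zpow_natCast]
    exact zpow_eq_pow_emod hN hprim.pow_eq_one A
  have hℓP : (ℓ : 𝓞 Qbar) ∈ τ • 𝔏 := by
    have h1 := Ideal.smul_mem_pointwise_smul τ _ 𝔏 h𝔏
    have h2 : τ • (ℓ : 𝓞 Qbar) = ℓ := map_natCast (MulSemiringAction.toRingHom _ (𝓞 Qbar) τ) ℓ
    rwa [h2] at h1
  have hP : (τ • 𝔏).IsPrime := by
    rw [Ideal.pointwise_smul_eq_comap]
    exact Ideal.comap_isPrime _ _
  refine ⟨hP, hℓP, hy ▸ hprim.pow_of_coprime _ hcop, ?_⟩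
  obtain ⟨ι, -, hι1, hι2⟩ := exists_residue hP hℓP
  have h1 : zetaInt N ^ j - (ξ : 𝓞 Qbar) ^ ((ℓ - 1) / N) ∈ τ • 𝔏 := by
    have h1 := Ideal.smul_mem_pointwise_smul τ _ 𝔏 hξ𝔏
    have h2 : τ • zetaInt N = zetaInt N ^ j := NumberField.RingOfIntegers.ext hj
    have h3 : τ • (ξ : 𝓞 Qbar) = ξ := map_intCast (MulSemiringAction.toRingHom _ (𝓞 Qbar) τ) ξ
    rwa [smul_sub, smul_pow', h2, h3] at h1
  have h2 : Ideal.Quotient.mk (τ • 𝔏) (zetaInt N ^ j) = ι ((ξ : ZMod ℓ) ^ ((ℓ - 1) / N)) := by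
    rw [Ideal.Quotient.eq.2 h1, map_pow, map_pow, hι2]
  have h3 : zetaInt N = (zetaInt N ^ j) ^ A₀ := by
    rw [← pow_mul]
    exact NumberField.RingOfIntegers.ext hjA.symm
  rw [← Ideal.Quotient.eq, ← hι1, h3, map_pow, h2, hy, map_pow ι _ A₀]

lemma exists_galFix_cyc_iff {F : IntermediateField ℚ Qbar} (hN : N ≠ 0) (hF : F ≤ cyc N)
    (x : Qbar) : (∃ σ ∈ galFix (cyc N) F, (σ ⟨zeta N, zeta_mem_cyc N⟩ : Qbar) = x)
      ↔ x ∈ galOrbit F (zeta N) := by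
  rw [mem_galOrbit]
  constructor
  · rintro ⟨σ, hσ, rfl⟩
    have h1 : ∀ x : cyc N, AlgEquiv.liftNormal σ Qbar x = (σ x : Qbar) :=
      AlgEquiv.liftNormal_commutes σ Qbar
    refine ⟨AlgEquiv.liftNormal σ Qbar, ?_, h1 ⟨zeta N, zeta_mem_cyc N⟩⟩
    rw [IntermediateField.mem_fixingSubgroup_iff]
    intro y hy
    exact (h1 ⟨y, hF hy⟩).trans (congrArg Subtype.val (mem_galFix.1 hσ ⟨y, hF hy⟩ hy))
  · rintro ⟨σ, hσ, rfl⟩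
    have key : ∀ (τ : Gal(Qbar/ℚ)), ∀ x ∈ cyc N, τ x ∈ cyc N := by
      intro τ
      suffices h : cyc N ≤ (cyc N).comap τ.toAlgHom from h
      refine IntermediateField.adjoin_simple_le_iff.2 ?_
      obtain ⟨j, -, hj⟩ := exists_apply_zeta_eq_pow hN τ
      change τ (zeta N) ∈ cyc N
      rw [hj]
      exact pow_mem (zeta_mem_cyc N) j
    obtain ⟨γ, hγ⟩ := exists_galOf_restrict (key σ) (key σ⁻¹)
    refine ⟨γ, mem_galFix.2 fun x hx => Subtype.ext ?_, hγ _⟩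
    rw [hγ]
    exact (IntermediateField.mem_fixingSubgroup_iff _ _).1 hσ x hx

lemma IsRepresentativeSystem.prod_eq {F : IntermediateField ℚ Qbar} (hN : N ≠ 0)
    (hF : F ≤ cyc N) {I : Finset ℤ} (hI : IsRepresentativeSystem F N I) {M : Type*} [CommMonoid M]
    (g : Qbar → M) : ∏ i ∈ I, g (zeta N ^ i) = ∏ z ∈ galOrbit F (zeta N), g z := by
  refine Finset.prod_bij (fun i _ => zeta N ^ i) ?_ ?_ ?_ ?_
  · intro i hi
    exact (exists_galFix_cyc_iff hN hF _).1 (hI.1 i hi)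
  · intro i hi j hj hij
    obtain ⟨σ, hσ, h⟩ := hI.1 i hi
    exact (hI.2 σ hσ).unique ⟨hi, h⟩ ⟨hj, h.trans hij⟩
  · intro z hz
    obtain ⟨σ, hσ, h⟩ := (exists_galFix_cyc_iff hN hF _).2 hz
    obtain ⟨i, ⟨hi, hi'⟩, -⟩ := hI.2 σ hσ
    exact ⟨i, hi, hi'.symm.trans h⟩
  · exact fun _ _ => rfl

end Congruences

/-! ### The twisted norm from F_n to F -/

section TwistedNorm

open Classical in
/-- The exponent of an `N`-th root of unity with respect to `ζ_N`. -/
def zetaLog (N : ℕ) (x : Qbar) : ZMod N :=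
  if h : ∃ j : ℕ, x = zeta N ^ j then (h.choose : ZMod N) else 0

lemma zetaLog_pow {N : ℕ} (hN : N ≠ 0) (j : ℕ) : zetaLog N (zeta N ^ j) = j := by
  have h : ∃ i : ℕ, zeta N ^ j = zeta N ^ i := ⟨j, rfl⟩
  rw [zetaLog, dif_pos h, eq_comm]
  exact (zeta_pow_eq_zeta_pow_iff hN).1 h.choose_spec

variable {p : ℕ} [Fact p.Prime] {F : IntermediateField ℚ Qbar} [NumberField F]

/-- The twisted norm of the cyclotomic number from `F_n` to `F`. -/
lemma prod_rep_epsilon_pow {d a n r : ℕ} (hd : d ≠ 0) (hF : F ≤ cyc (d * p ^ a)) (han : a ≤ n)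
    [Fintype (galS p F ⧸ (galSLayer p F n).subgroupOf (galS p F))] {I : Finset ℤ}
    (hI : IsRepresentativeSystem F (d * p ^ n) I) :
    ∏ c : galS p F ⧸ (galSLayer p F n).subgroupOf (galS p F),
      liftGal ((rep c : galS p F) : GS p F) (epsilon p F a d n)
        ^ (PadicInt.toZModPow n (kappa p F (rep c : galS p F) : ℤ_[p]) ^ (r - 1)).val
      = ∏ i ∈ I, (1 - zeta (d * p ^ n) ^ i) ^ ((i : ZMod (p ^ n)) ^ (r - 1)).val := by
  have hp : p.Prime := Fact.out
  have hpn : p ^ n ≠ 0 := pow_ne_zero n hp.ne_zero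
  have : NeZero (p ^ n) := ⟨hpn⟩
  have hN : d * p ^ n ≠ 0 := mul_ne_zero hd hpn
  have hle : layer p F n ≤ cyc (d * p ^ n) := layer_le_cyc hd hF han le_rfl
  have hzeta : zeta (d * p ^ n) ^ d = zeta (p ^ n) := zeta_pow_of_mul hd
  -- The exponent as a function of the conjugate itself: the d-th power of ζ_{d p^n}^i is ζ_{p^n}^i,
  -- and that of s(c)(z), for z conjugate to ζ_{d p^n} over F_n, is ζ_{p^n}^{κ(s(c))}. Both products
  -- thus become one product over the F-orbit.
  let K : Qbar → ℕ := fun x => (zetaLog (p ^ n) (x ^ d) ^ (r - 1)).val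
  have h1 := hI.prod_eq hN (le_sup_left.trans hle) fun z => (1 - z) ^ K z
  have h2 : ∀ i ∈ I, (1 - zeta (d * p ^ n) ^ i) ^ K (zeta (d * p ^ n) ^ i)
      = (1 - zeta (d * p ^ n) ^ i) ^ ((i : ZMod (p ^ n)) ^ (r - 1)).val := by
    intro i _
    have h3 : (zeta (d * p ^ n) ^ i) ^ d = zeta (p ^ n) ^ (i % (p ^ n : ℕ)).toNat := by
      rw [← zpow_natCast, ← zpow_mul, mul_comm i, zpow_mul, zpow_natCast, hzeta]
      exact zpow_eq_pow_emod hpn (zeta_pow_self _) i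
    simp only [K]
    rw [h3, zetaLog_pow hpn, emod_toNat_cast hpn]
  rw [Finset.prod_congr rfl h2] at h1
  rw [h1, ← (isCosetSystem_liftGal (p := p) (F := F) (K := layer p F n) le_rfl le_sup_left
    (layer_le_Omega hp.ne_zero n)).prod_galOrbit le_sup_left hle]
  refine Finset.prod_congr rfl fun c _ => ?_
  rw [epsilon_eq hd hF, max_eq_right han, map_prod, ← Finset.prod_pow]
  refine Finset.prod_congr rfl fun z hz => ?_
  rw [map_sub, map_one]
  congr 1
  obtain ⟨σ, hσ, rfl⟩ := mem_galOrbit.1 hz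
  simp only [K]
  rw [← map_pow (liftGal _), ← map_pow σ, hzeta,
    (IntermediateField.mem_fixingSubgroup_iff _ _).1 hσ _
    ((le_sup_right : cyc (p ^ n) ≤ layer p F n) (zeta_mem_cyc _)), liftGal_zeta, zetaLog_pow hpn,
    ZMod.natCast_zmod_val]

/-- A twisted product of residues, up to a `q`-th power. -/
lemma exists_prod_zpow_eq {ℓ q s : ℕ} [Fact ℓ.Prime] [NeZero q] (I : Finset ℤ) {β : ℤ → ZMod ℓ}
    (hβ : ∀ i ∈ I, β i ≠ 0) :
    ∃ u : ZMod ℓ, ∏ i ∈ I, β i ^ (i ^ s) = u ^ q * ∏ i ∈ I, β i ^ ((i : ZMod q) ^ s).val := by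
  have h : ∀ i : ℤ, ∃ t : ℤ, i ^ s = ((((i : ZMod q) ^ s).val : ℕ) : ℤ) + q * t := by
    intro i
    have h1 : ((i ^ s : ℤ) : ZMod q) = (((((i : ZMod q) ^ s).val : ℕ) : ℤ) : ZMod q) := by
      rw [Int.cast_natCast, ZMod.natCast_zmod_val, Int.cast_pow]
    obtain ⟨t, ht⟩ := (ZMod.intCast_eq_intCast_iff_dvd_sub _ _ _).1 h1.symm
    exact ⟨t, by rw [← ht]; ring⟩
  choose t ht using h
  refine ⟨∏ i ∈ I, β i ^ t i, ?_⟩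
  rw [← Finset.prod_pow, ← Finset.prod_mul_distrib]
  refine Finset.prod_congr rfl fun i hi => ?_
  rw [ht i, zpow_add₀ (hβ i hi), zpow_natCast, mul_comm, mul_comm (q : ℤ), zpow_mul, zpow_natCast]

end TwistedNorm

/-! ### The special element in the residue fields -/

section Main

variable {p : ℕ} [Fact p.Prime] {F : IntermediateField ℚ Qbar} [NumberField F]

lemma isResidueKummerClass_res_special {d a n r ℓ : ℕ} [Fact ℓ.Prime] (hd : d ≠ 0)
    (hF : F ≤ cyc (d * p ^ a)) (hr : r ≠ 0) (hn : n ≠ 0) (han : a ≤ n) {P : Ideal (𝓞 Qbar)}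
    {y : ZMod ℓ} (hP : IsResidueOfZeta (d * p ^ n) ℓ P y) {I : Finset ℤ}
    (hI : IsRepresentativeSystem F (d * p ^ n) I) :
    IsResidueKummerClass p F r n ℓ P (∏ i ∈ I, (1 - y ^ i) ^ (i ^ (r - 1)))
      (H1.res (twist p F r n) inf_le_right (special p F a d r n)) := by
  have hp : p.Prime := Fact.out
  have hpn : p ^ n ≠ 0 := pow_ne_zero n hp.ne_zero
  have : NeZero (p ^ n) := ⟨hpn⟩
  have hN : d * p ^ n ≠ 0 := mul_ne_zero hd hpn
  have hle : layer p F n ≤ cyc (d * p ^ n) := layer_le_cyc hd hF han le_rfl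
  have hleΩ : layer p F n ≤ Omega p F := layer_le_Omega hp.ne_zero n
  let U := galS p F
  let V := galSLayer p F n
  let _ := Fintype.ofFinite (galS p F ⧸ (galSLayer p F n).subgroupOf (galS p F))
  have hεd := dvdPrimePow_epsilon (F := F) hd hF hn
  obtain ⟨hε0, v, hv, hvε, f, hf, hfx⟩ := isKummerClass_iff.1
    (isKummerClass_kummerClass (r := r) (epsilon_mem_layer (a := a) (d := d) n) hεd)
  -- Since y and ζ_N have the same order, y^i = 1 would make the primitive root ζ_N^i trivial,
  -- although p divides N.
  have hβ : ∀ i ∈ I, 1 - y ^ i ≠ 0 := by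
    intro i hi h0
    have h1 := (exists_galFix_cyc_iff hN (le_sup_left.trans hle) _).1 (hI.1 i hi)
    have h2 := (isPrimitiveRoot_of_mem_galOrbit hN h1).eq_orderOf
    have h3 : y ^ (i % (d * p ^ n : ℕ)).toNat = y ^ 0 := by
      rw [← zpow_eq_pow_emod hN hP.primitive.pow_eq_one, pow_zero]
      exact (sub_eq_zero.1 h0).symm
    have h5 : IsOfFinOrder y :=
      isOfFinOrder_iff_pow_eq_one.2 ⟨_, Nat.pos_of_ne_zero hN, hP.primitive.pow_eq_one⟩
    rw [h5.pow_eq_pow_iff_modEq, ← hP.primitive.eq_orderOf, ← ZMod.natCast_eq_natCast_iff,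
      ← zeta_pow_eq_zeta_pow_iff hN, pow_zero, ← zpow_eq_pow_emod hN (zeta_pow_self _)] at h3
    rw [h3, orderOf_one] at h2
    have h6 : p ∣ d * p ^ n := (dvd_pow_self p hn).mul_left d
    rw [h2] at h6
    exact hp.one_lt.ne' (Nat.dvd_one.1 h6)
  obtain ⟨u, hu⟩ := exists_prod_zpow_eq (q := p ^ n) (s := r - 1) I hβ
  let k : U ⧸ V.subgroupOf U → ℕ := fun c =>
    (PadicInt.toZModPow n (kappa p F (rep c : U) : ℤ_[p]) ^ (r - 1)).val
  set w : Qbar := ∏ c : U ⧸ V.subgroupOf U, liftGal ((rep c : U) : GS p F) v ^ k c with hw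
  have hwΩ : w ∈ Omega p F := prod_liftGal_mem hv k
  have hwpow : w ^ p ^ n
      = ∏ i ∈ I, (1 - zeta (d * p ^ n) ^ i) ^ ((i : ZMod (p ^ n)) ^ (r - 1)).val := by
    rw [← prod_rep_epsilon_pow hd hF han hI, hw, ← Finset.prod_pow]
    refine Finset.prod_congr rfl fun c _ => ?_
    rw [← hvε, map_pow, ← pow_mul, ← pow_mul, mul_comm]
  let z : ℤ → 𝓞 Qbar := fun i => zetaInt (d * p ^ n) ^ (i % (d * p ^ n : ℕ)).toNat
  have hz : ∀ i, (z i : Qbar) = zeta (d * p ^ n) ^ i := fun i =>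
    (zpow_eq_pow_emod hN (zeta_pow_self _) i).symm
  let W : 𝓞 Qbar := ∏ i ∈ I, (1 - z i) ^ ((i : ZMod (p ^ n)) ^ (r - 1)).val
  have hW : (W : Qbar) = w ^ p ^ n := by
    rw [hwpow, NumberField.RingOfIntegers.coe_eq_algebraMap, map_prod]
    refine Finset.prod_congr rfl fun i _ => ?_
    rw [map_pow, map_sub, map_one, ← NumberField.RingOfIntegers.coe_eq_algebraMap, hz]
  have hwi : IsIntegral ℤ w :=
    IsIntegral.of_pow (Nat.pos_of_ne_zero hpn) (hW ▸ W.isIntegral_coe)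
  have hwi' : IsIntegral ℤ (⟨w, hwΩ⟩ : Omega p F) :=
    (isIntegral_algHom_iff (algebraMap (Omega p F) Qbar).toIntAlgHom
      (algebraMap (Omega p F) Qbar).injective).1 hwi
  let w' : 𝓞 (Omega p F) := ⟨⟨w, hwΩ⟩, hwi'⟩
  have hw' : ((algebraMap (𝓞 (Omega p F)) (𝓞 Qbar) w' : 𝓞 Qbar) : Qbar) = w := rfl
  have hw'pow : algebraMap (𝓞 (Omega p F)) (𝓞 Qbar) w' ^ p ^ n = W := by
    apply NumberField.RingOfIntegers.ext
    rw [hW]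
    rfl
  -- The integer factor u corrects the root for the reduction of the exponents i^(r-1) modulo p^n.
  -- It is fixed by Galois, so the cocycle is still that of w.
  refine ⟨Finset.prod_ne_zero_iff.2 fun i hi => zpow_ne_zero _ (hβ i hi),
    (u.val : 𝓞 (Omega p F)) * w', ?_, Z1.res _ inf_le_right
      ⟨corFun (twist p F r n) f.1, corFun_mem_Z1 (isOpen_galFix _ _) f.2⟩, ?_, ?_⟩
  · obtain ⟨ι, -, hι1, hι2⟩ := hP.exists_residue
    rw [map_mul, map_natCast, mul_pow, hw'pow, ← Ideal.Quotient.eq, map_mul, map_pow, ← hι1,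
      ← hι1, hu, map_mul, map_pow]
    congr 1
    rw [map_prod, map_prod]
    refine Finset.prod_congr rfl fun i _ => ?_
    rw [map_pow, map_pow, map_sub, map_sub, map_one, map_one, hι2,
      zpow_eq_pow_emod hN hP.primitive.pow_eq_one]
  · intro σ
    -- The congruence modulo P is an equality of algebraic integers.
    convert P.zero_mem
    rw [sub_eq_zero]
    apply NumberField.RingOfIntegers.ext
    -- As σ and all its conjugates fix F_n, it fixes every coset, as `liftGal_prod_rep` requires.
    have hσV : (σ : GS p F) ∈ V := decomp_le_galFix hP hN hle hleΩ σ.2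
    have hσc : ∀ c : U ⧸ V.subgroupOf U, (⟨σ, σ.2.2⟩ : U) • c = c := by
      intro c
      have h1 : (⟨σ, σ.2.2⟩ : U) • c = QuotientGroup.mk ((⟨σ, σ.2.2⟩ : U) * rep c) := by
        conv_lhs => rw [← rep_spec c]
        rfl
      rw [h1]
      refine Eq.trans ?_ (rep_spec c)
      rw [eq_comm, mk_eq_mk_iff]
      have h2 := conj_mem_galFix hN hle hσV (rep c : U)
      rw [mul_assoc] at h2
      exact h2
    have h1 := liftGal_prod_rep hr hv hf k (fun c => ZMod.natCast_zmod_val _) ⟨σ, σ.2.2⟩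
      fun c => by rw [hσc]
    rw [coe_smul_ringOfIntegers]
    change liftGal (σ : GS p F) ((u.val : Qbar) * w)
      = zeta (p ^ n) ^ (corFun (twist p F r n) f.1 (⟨σ, σ.2.2⟩ : U)).val * ((u.val : Qbar) * w)
    rw [map_mul, map_natCast, h1, mul_left_comm]
  · change H1.res _ _ (H1.cor _ _ _ _ _) = _
    rw [hfx]
    rfl

end Main

end TwistedCyclotomic

open TwistedCyclotomic in
theorem proposition6p3
    -- an odd prime number `p`
    (p : ℕ) [Fact p.Prime] (hp : p ≠ 2)
    -- a totally real abelian number field `F ⊆ Qbar ⊆ ℂ` of conductor `d p^a`, `p ∤ d`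
    (F : IntermediateField ℚ Qbar) [NumberField F] [IsAbelianGalois ℚ F]
    [NumberField.IsTotallyReal F]
    (d a : ℕ) (hd : ¬ p ∣ d) (hF : IsConductor F (d * p ^ a))
    -- an odd twist `r > 1`, and a level `n ≥ 1` with `F ⊆ ℚ(ζ_{d p^n})`
    (r : ℕ) (hr : Odd r) (hr1 : 1 < r)
    (n : ℕ) (hn : 1 ≤ n) (han : a ≤ n)
    -- a prime number `ℓ ≡ 1 mod d p^n`, and a prime ideal `𝔏` above `ℓ`
    (ℓ : ℕ) [Fact ℓ.Prime] (hℓ : ℓ ≡ 1 [MOD d * p ^ n])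
    (𝔏 : Ideal (𝓞 Qbar)) [𝔏.IsPrime] (h𝔏 : (ℓ : 𝓞 Qbar) ∈ 𝔏)
    -- a primitive root `ξ` modulo `ℓ` with `ζ_{d p^n} ≡ ξ ^ ((ℓ - 1) / (d p^n))` modulo `𝔏`
    (ξ : ℤ) (hξ : orderOf (ξ : ZMod ℓ) = ℓ - 1)
    (hξ𝔏 : zetaInt (d * p ^ n) - (ξ : 𝓞 Qbar) ^ ((ℓ - 1) / (d * p ^ n)) ∈ 𝔏)
    -- representatives in `ℤ` of `Gal(ℚ(ζ_{d p^n})/F)`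
    (I : Finset ℤ) (hI : IsRepresentativeSystem F (d * p ^ n) I)
    -- for each `g ∈ G`, an integer `A g` representing `g⁻¹`, and a lift `τ g` of `g` such that
    -- `(τ g)⁻¹` acts on `ζ_{d p^n}` as raising to the power `A g`
    (A : GalOf F → ℤ) (τ : GalOf F → Gal(Qbar/ℚ))
    (hτ : ∀ (g : GalOf F) (x : F), τ g (x : Qbar) = (g x : Qbar))
    (hA : ∀ g : GalOf F, τ g (zeta (d * p ^ n) ^ A g) = zeta (d * p ^ n)) :
    -- `c^F(r)` is an element of `H¹(G_S, ℤ_p(r))`, and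
    special p F a d r ∈ H1Zp p F r ∧
    -- `φ_{ℓ,n} (c^F(r)) = (∏_{i ∈ I} (1 - ξ ^ (a_g i (ℓ-1)/(d p^n))) ^ (i ^ (r-1)) ⊗ t(r-1)_n)_g`
    ∀ g : GalOf F,
      IsResidueKummerClass p F r n ℓ (conjPrime F 𝔏 τ g)
        (∏ i ∈ I, (1 - (ξ : ZMod ℓ) ^ (A g * i * (((ℓ - 1) / (d * p ^ n) : ℕ) : ℤ)))
          ^ (i ^ (r - 1)))
        (phi p F r n 𝔏 τ (special p F a d r n) g) := by
  have hd0 : d ≠ 0 := fun h => hd (h ▸ dvd_zero p)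
  have hr0 : r ≠ 0 := by omega
  have hN : d * p ^ n ≠ 0 := mul_ne_zero hd0 (pow_ne_zero _ (Fact.out : p.Prime).ne_zero)
  refine ⟨special_mem_H1Zp hd0 hF.1.2 hr0, fun g => ?_⟩
  have hP : IsResidueOfZeta (d * p ^ n) ℓ (conjPrime F 𝔏 τ g) _ :=
    isResidueOfZeta_smul hN hℓ inferInstance h𝔏 hξ hξ𝔏 (hA g)
  have h := isResidueKummerClass_res_special hd0 hF.1.2 hr0 (by omega) han hP hI
  simp only [← zpow_mul, mul_right_comm (A g)] at h ⊢
  exact h
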